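/- A $k$-uniform hypergraph $H$ has a finite vertex set $V(H)$ and an edge set $E(H)$ consisting of $k$-element subsets of $V(H)$. Its minimum $\ell$-degree $\delta_\ell(H)$ is the minimum, over all $\ell$-element sets $S \subseteq V(H)$, of the number of edges containing $S$. Let $\mathcal B_{n,k}$ be the $k$-uniform hypergraph whose vertex set is the disjoint union of sets $A$ and $B$ with $|A| = \lfloor n/2 \rfloor$ and $|B| = \lceil n/2 \rceil$, and whose edges are all $k$-element subsets of $A \cup B$ meeting $A$ in an odd number of vertices; let $\overline{\mathcal B}_{n,k}$ be its complement, whose edges are the $k$-subsets meeting $A$ in an even number of vertices. For $k$-uniform hypergraphs $H, H'$ on $n$ vertices, $H$ is $\varepsilon$-close to $H'$ if there is an isomorphic copy $\tilde H$ of $H$ with $V(\tilde H) = V(H')$ and $|E(\tilde H) \triangle E(H')| \le \varepsilon n^k$. A matching is a set $M$ of pairwise disjoint edges, and $V(M)$ is the set of vertices it covers; it is perfect if it covers all vertices. A matching $M$ in $H$ absorbs a set $Q \subseteq V(H)$ if both induced subhypergraphs $H[V(M)]$ and $H[V(M) \cup Q]$ contain perfect matchings. **Theorem 3.1.** Let $\varepsilon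 > 0$ and let $k, \ell$ be integers with $k \ge 3$ and $k/2 \le \ell \le k-1$. Then there exist $\alpha, \xi > 0$ and $n_0 \in \mathbb N$ such that the following holds. Suppose that $H$ is a $k$-uniform hypergraph on $n \ge n_0$ vertices with $$\delta_\ell(H) \ge \left(\tfrac12 - \alpha\right)\binom{n-\ell}{k-\ell}.$$ Then $H$ is $\varepsilon$-close to $\mathcal B_{n,k}$ or to $\overline{\mathcal B}_{n,k}$, or $H$ contains a matching $M$ of size $|M| \le \xi n/k$ that absorbs every set $W \subseteq V(H) \setminus V(M)$ such that $|W|$ is a multiple of $k$ and $|W| \le \xi^2 n$. -/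

import Mathlib

open Finset

/-- A `k`-uniform hypergraph: a finite vertex set together with a family of `k`-element subsets
of it. The vertices are taken from an ambient type `V`. -/
@[ext]
structure UniformHypergraph (V : Type*) (k : ℕ) where
  /-- the vertex set -/
  verts : Finset V
  /-- the edge set -/
  edges : Finset (Finset V)
  edges_subset : edges ⊆ verts.powersetCard k

namespace UniformHypergraph

variable {V : Type*} {U : Type*} {k : ℕ}

/-- The degree of a vertex set `S`: the number of edges containing `S`. -/
def degree [DecidableEq V] (H : UniformHypergraph V k) (S : Finset V) : ℕ :=
  #{e ∈ H.edges | S ⊆ e}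

/-- The minimum `l`-degree: the minimum of the degrees of the `l`-element sets of vertices
(with value `0` if there are fewer than `l` vertices). -/
noncomputable def minDegree [DecidableEq V] (H : UniformHypergraph V k) (l : ℕ) : ℕ :=
  sInf {d : ℕ | ∃ S : Finset V, S ⊆ H.verts ∧ #S = l ∧ H.degree S = d}

/-- The complement: the non-edges among the `k`-subsets of the vertex set become the edges. -/
def compl [DecidableEq V] (H : UniformHypergraph V k) : UniformHypergraph V k where
  verts := H.verts
  edges := H.verts.powersetCard k \ H.edges
  edges_subset := Finset.sdiff_subset

/-- The subhypergraph induced by a set `A` of vertices. -/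
def induce [DecidableEq V] (H : UniformHypergraph V k) (A : Finset V) :
    UniformHypergraph V k where
  verts := A
  edges := H.edges ∩ A.powersetCard k
  edges_subset := Finset.inter_subset_right

/-- `H'` is an isomorphic copy of `H`: some bijection of the vertex sets carries the edge set of
`H` onto the edge set of `H'`. -/
def IsCopy [DecidableEq U] (H : UniformHypergraph V k) (H' : UniformHypergraph U k) : Prop :=
  ∃ f : V → U, Set.BijOn f H.verts H'.verts ∧ H'.edges = H.edges.image (Finset.image f)

/-- `H` is `ε`-close to `H'`: some isomorphic copy of `H` on the vertex set of `H'` differs from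
`H'` in at most `ε n ^ k` edges, where `n` is the number of vertices. -/
def IsClose [DecidableEq U] (ε : ℝ) (H : UniformHypergraph V k) (H' : UniformHypergraph U k) :
    Prop :=
  ∃ H₁ : UniformHypergraph U k, H.IsCopy H₁ ∧ H₁.verts = H'.verts ∧
    (#(symmDiff H₁.edges H'.edges) : ℝ) ≤ ε * (#H.verts : ℝ) ^ k

/-- A matching: a set of pairwise disjoint edges. -/
def IsMatching (H : UniformHypergraph V k) (M : Finset (Finset V)) : Prop :=
  M ⊆ H.edges ∧ (M : Set (Finset V)).PairwiseDisjoint id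

/-- The set of vertices covered by a family of edges. -/
def support [DecidableEq V] (M : Finset (Finset V)) : Finset V :=
  M.biUnion id

/-- A perfect matching: a matching that covers all vertices. -/
def IsPerfectMatching [DecidableEq V] (H : UniformHypergraph V k) (M : Finset (Finset V)) :
    Prop :=
  H.IsMatching M ∧ support M = H.verts

/-- `S` is an absorbing set for `Q`: both `H[S]` and `H[S ∪ Q]` contain perfect matchings. -/
def IsAbsorbingSet [DecidableEq V] (H : UniformHypergraph V k) (S Q : Finset V) : Prop :=
  S ⊆ H.verts ∧ Q ⊆ H.verts ∧
    (∃ M, (H.induce S).IsPerfectMatching M) ∧ ∃ M, (H.induce (S ∪ Q)).IsPerfectMatching M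

/-- The matching `M` absorbs `Q`: the set of vertices covered by `M` is an absorbing set
for `Q`. -/
def Absorbs [DecidableEq V] (H : UniformHypergraph V k) (M : Finset (Finset V)) (Q : Finset V) :
    Prop :=
  H.IsMatching M ∧ H.IsAbsorbingSet (support M) Q

/-- The hypergraph on `A ∪ B` (used for disjoint `A` and `B`) whose edges are the `k`-sets that
meet `A` in an odd number of vertices. -/
def oddPartite [DecidableEq V] (k : ℕ) (A B : Finset V) : UniformHypergraph V k where
  verts := A ∪ B
  edges := {e ∈ (A ∪ B).powersetCard k | Odd #(e ∩ A)}
  edges_subset := Finset.filter_subset _ _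

/-- The balanced hypergraph `B_{n,k}`, on the vertex set `{0, …, n - 1}`, with classes
`A = {0, …, ⌊n/2⌋ - 1}` and `B = {⌊n/2⌋, …, n - 1}` of sizes `⌊n/2⌋` and `⌈n/2⌉`. -/
def balancedOdd (n k : ℕ) : UniformHypergraph ℕ k :=
  oddPartite k (Finset.range (n / 2)) (Finset.Ico (n / 2) n)

end UniformHypergraph

/-! Call two vertices reachable if a positive proportion of the sets `U` of some fixed size connect
them: `U` together with either vertex is the vertex set of a matching. If all pairs are reachable,
every `k`-set `Q` has a positive density of absorbers: take an edge `e` disjoint from `Q` and a set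
`U` connecting `Q` to `e` vertex by vertex; then `e ∪ U` and `e ∪ U ∪ Q` are both matchable
(`exists_dense_absorber`). A small family of disjoint absorbers, linearly many of them for each `Q`,
then covers the vertices of the required matching (`exists_absorbing_matching`).

It remains to show that non-reachability forces the parity structure. The degree condition enters
through the vertex degrees it implies (`le_card_link`). With `k = m + 1`, every link contains almost
half of all `m`-sets, so among any three vertices two share many link sets, and a common link set is
a connecting set. Hence either every pair is reachable, directly or through common neighbours, or
almost all vertices split into classes `A` and `B` of pairwise link-close vertices
(`HasLargeLinks.exists_partition`). In the second case, record for each vertex which sizes of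
intersection with `A` are frequent among its link sets. Two vertices with a frequent size in common
are reachable, since link sets of equal type can be exchanged class by class. So if some pair is not
reachable, there are vertices `x`, `y` with disjoint sets `I`, `J` of frequent sizes, and few
vertices share sizes with both (`exists_reach_or_partition`).

The `m`-sets of type `I` and those of type `J` then make up almost half of all `m`-sets each, and
almost every link is close to one of these two families, the same one throughout a class. Reading an
edge from its vertices in `A` and from those in `B` forces `I` and `J` to alternate, and a signed
count of `m`-sets forces `A` and `B` to have almost equal size (`exists_parity`). This is closeness
to the parity hypergraph or its complement (`isClose_of_parity`). -/

set_option linter.unusedSectionVars false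

namespace UniformHypergraph

/-! ### Matchable sets and connecting sets -/

section Basic

variable {V : Type*} [DecidableEq V] {k : ℕ} {H : UniformHypergraph V k}

/-- `S` is the vertex set of a matching of `H`. -/
def Matchable (H : UniformHypergraph V k) (S : Finset V) : Prop :=
  ∃ M, H.IsMatching M ∧ support M = S

theorem edge_subset {e : Finset V} (he : e ∈ H.edges) : e ⊆ H.verts :=
  (mem_powersetCard.1 (H.edges_subset he)).1

theorem edge_card {e : Finset V} (he : e ∈ H.edges) : #e = k :=
  (mem_powersetCard.1 (H.edges_subset he)).2

theorem Matchable.empty : H.Matchable ∅ :=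
  ⟨∅, ⟨empty_subset _, by simp⟩, by simp [support]⟩

theorem Matchable.edge {e : Finset V} (he : e ∈ H.edges) : H.Matchable e :=
  ⟨{e}, ⟨by simpa using he, by simp⟩, by simp [support]⟩

theorem Matchable.union {S T : Finset V} (hS : H.Matchable S) (hT : H.Matchable T)
    (hST : Disjoint S T) : H.Matchable (S ∪ T) := by
  obtain ⟨M, ⟨hM, hMd⟩, rfl⟩ := hS
  obtain ⟨M', ⟨hM', hMd'⟩, rfl⟩ := hT
  refine ⟨M ∪ M', ⟨union_subset hM hM', ?_⟩, by simp [support, union_biUnion]⟩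
  rw [coe_union, Set.pairwiseDisjoint_union]
  refine ⟨hMd, hMd', fun e he e' he' _ => ?_⟩
  exact hST.mono (subset_biUnion_of_mem id he) (subset_biUnion_of_mem id he')

theorem Matchable.subset {S : Finset V} (hS : H.Matchable S) : S ⊆ H.verts := by
  obtain ⟨M, ⟨hM, -⟩, rfl⟩ := hS
  exact biUnion_subset.2 fun e he => edge_subset (hM he)

theorem Matchable.exists_isPerfectMatching {S : Finset V} (hS : H.Matchable S) :
    ∃ M, (H.induce S).IsPerfectMatching M := by
  obtain ⟨M, ⟨hM, hMd⟩, rfl⟩ := hS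
  refine ⟨M, ⟨fun e he => ?_, hMd⟩, rfl⟩
  simp only [induce, mem_inter, mem_powersetCard]
  exact ⟨hM he, subset_biUnion_of_mem id he, edge_card (hM he)⟩

theorem IsMatching.card_support {M : Finset (Finset V)} (hM : H.IsMatching M) :
    #(support M) = k * #M := by
  rw [support, card_biUnion (fun e he e' he' h => hM.2 he he' h),
    sum_congr rfl (fun e he => (edge_card (hM.1 he) : #(id e) = k))]
  simp [mul_comm]

/-- `U` connects the vertex sets `X` and `Y`: both `U ∪ X` and `U ∪ Y` are vertex sets of
matchings. -/
structure Connects (H : UniformHypergraph V k) (X Y U : Finset V) : Prop where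
  disjoint_left : Disjoint U X
  disjoint_right : Disjoint U Y
  matchable_left : H.Matchable (U ∪ X)
  matchable_right : H.Matchable (U ∪ Y)

theorem Connects.union {X Y U X' Y' U' : Finset V} (h : H.Connects X Y U)
    (h' : H.Connects X' Y' U') (hU : Disjoint U U') (h₁ : Disjoint U X') (h₂ : Disjoint U Y')
    (h₃ : Disjoint U' X) (h₄ : Disjoint U' Y) (hX : Disjoint X X') (hY : Disjoint Y Y') :
    H.Connects (X ∪ X') (Y ∪ Y') (U ∪ U') where
  disjoint_left := by simp [h.disjoint_left, h'.disjoint_left, h₁, h₃]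
  disjoint_right := by simp [h.disjoint_right, h'.disjoint_right, h₂, h₄]
  matchable_left := by
    rw [union_union_union_comm]
    exact h.matchable_left.union h'.matchable_left (by simp [*, h₃.symm])
  matchable_right := by
    rw [union_union_union_comm]
    exact h.matchable_right.union h'.matchable_right (by simp [*, h₄.symm])

/-- The spare vertex `z` joins the connecting set: `U'` takes it when `x` has to be covered, and `U`
takes it when `y` has to be covered. -/
theorem Connects.trans {x y z : V} {U U' : Finset V} (h : H.Connects {x} {z} U)
    (h' : H.Connects {z} {y} U') (hU : Disjoint U U') (hx : x ∉ U') (hy : y ∉ U)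
    (hxz : x ≠ z) (hyz : y ≠ z) : H.Connects {x} {y} (({z} ∪ U) ∪ U') := by
  have h1 := h.disjoint_left
  have h2 := h.disjoint_right
  have h3 := h'.disjoint_left
  have h4 := h'.disjoint_right
  simp only [disjoint_singleton_right] at h1 h2 h3 h4
  refine ⟨by simp [*], by simp [*], ?_, ?_⟩
  · rw [show ({z} ∪ U) ∪ U' ∪ {x} = (U ∪ {x}) ∪ (U' ∪ {z}) by
      ext; simp only [mem_union, mem_singleton]; tauto]
    exact h.matchable_left.union h'.matchable_left (by simp [*, Ne.symm hxz])
  · rw [show ({z} ∪ U) ∪ U' ∪ {y} = (U ∪ {z}) ∪ (U' ∪ {y}) by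
      ext; simp only [mem_union, mem_singleton]; tauto]
    exact h.matchable_right.union h'.matchable_right (by simp [*])

/-- Used to pad connecting sets, so that sets arising in different ways get a common size. -/
theorem Connects.union_matchable {X Y U S : Finset V} (h : H.Connects X Y U)
    (hS : H.Matchable S) (hU : Disjoint S U) (hX : Disjoint S X) (hY : Disjoint S Y) :
    H.Connects X Y (U ∪ S) where
  disjoint_left := by simp [h.disjoint_left, hX]
  disjoint_right := by simp [h.disjoint_right, hY]
  matchable_left := by
    rw [union_right_comm]
    exact h.matchable_left.union hS (by simp [hU.symm, hX.symm])
  matchable_right := by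
    rw [union_right_comm]
    exact h.matchable_right.union hS (by simp [hU.symm, hY.symm])

/-- Link sets `T` of `x` and `T'` of `y` are exchanged: `x` uses the edge on `T` and leaves `T'` to
`U`, while `y` uses the edge on `T'` and leaves `T` to `U`. -/
theorem Connects.transfer {x y : V} {T T' U : Finset V} (h : H.Connects T T' U)
    (hx : insert x T ∈ H.edges) (hy : insert y T' ∈ H.edges) (hxT : x ∉ T) (hyT : y ∉ T')
    (hT : Disjoint T' T) (hxT' : x ∉ T') (hyT' : y ∉ T) (hxU : x ∉ U) (hyU : y ∉ U) :
    H.Connects {x} {y} ((T ∪ T') ∪ U) where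
  disjoint_left := by simp [*]
  disjoint_right := by simp [*]
  matchable_left := by
    rw [show T ∪ T' ∪ U ∪ {x} = insert x T ∪ (U ∪ T') by
      ext; simp only [mem_union, mem_singleton, mem_insert]; tauto]
    exact (Matchable.edge hx).union h.matchable_right
      (by simp [*, h.disjoint_left.symm, hT.symm])
  matchable_right := by
    rw [show T ∪ T' ∪ U ∪ {y} = insert y T' ∪ (U ∪ T) by
      ext; simp only [mem_union, mem_singleton, mem_insert]; tauto]
    exact (Matchable.edge hy).union h.matchable_left
      (by simp [*, h.disjoint_right.symm])

end Basic

/-! ### Families of positive density among the `c`-sets -/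

section Dense

variable {V : Type*} [DecidableEq V] {G : Finset V} {γ δ : ℝ} {a b c : ℕ}

open Classical in
/-- The property `P` holds for at least `γ |G| ^ c` of the `c`-element subsets of `G`. -/
def Dense (G : Finset V) (γ : ℝ) (c : ℕ) (P : Finset V → Prop) : Prop :=
  γ * (#G : ℝ) ^ c ≤ #{S ∈ G.powersetCard c | P S}

open Classical in
theorem Dense.mono {P Q : Finset V → Prop} (h : Dense G γ c P) (hδ : δ ≤ γ)
    (hPQ : ∀ S ⊆ G, #S = c → P S → Q S) : Dense G δ c Q := by
  unfold Dense at *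
  calc δ * (#G : ℝ) ^ c ≤ γ * (#G : ℝ) ^ c := by gcongr
    _ ≤ _ := h
    _ ≤ _ := by
      refine Nat.cast_le.2 (card_le_card fun S hS => ?_)
      simp only [mem_filter, mem_powersetCard] at hS ⊢
      exact ⟨hS.1, hPQ S hS.1.1 hS.1.2 hS.2⟩

theorem Dense.of_subset {P : Finset V → Prop} {s : Finset (Finset V)}
    (h : γ * (#G : ℝ) ^ c ≤ #s) (hs : ∀ S ∈ s, (S ⊆ G ∧ #S = c) ∧ P S) : Dense G γ c P := by
  classical
  refine h.trans (Nat.cast_le.2 (card_le_card fun S hS => ?_))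
  simp only [mem_filter, mem_powersetCard]
  exact hs S hS

theorem card_powersetCard_le_pow (G : Finset V) (c : ℕ) : #(G.powersetCard c) ≤ #G ^ c := by
  rw [card_powersetCard]; exact Nat.choose_le_pow _ _

open Classical in
/-- At most `|F| |G| ^ c` of the `(c + 1)`-element subsets of `G` meet `F`. -/
theorem card_filter_not_disjoint_le (G F : Finset V) (c : ℕ) :
    #{S ∈ G.powersetCard (c + 1) | ¬ Disjoint S F} ≤ #F * #G ^ c := by
  calc #{S ∈ G.powersetCard (c + 1) | ¬ Disjoint S F}
      ≤ #(F.biUnion fun v => (G.powersetCard c).image (insert v)) := by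
        apply card_le_card
        intro S hS
        simp only [mem_filter, mem_powersetCard, not_disjoint_iff] at hS
        obtain ⟨⟨hSG, hSc⟩, v, hvS, hvF⟩ := hS
        simp only [mem_biUnion, mem_image, mem_powersetCard]
        refine ⟨v, hvF, S.erase v, ⟨(erase_subset _ _).trans hSG, ?_⟩, insert_erase hvS⟩
        rw [card_erase_of_mem hvS, hSc]; rfl
    _ ≤ #F * #G ^ c := card_biUnion_le_card_mul _ _ _ fun v _ =>
        card_image_le.trans (card_powersetCard_le_pow _ _)

-- For `c > 0` the sets meeting `F` number at most `|F| |G| ^ (c - 1)`, which is at most half of the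
-- guaranteed count. For `c = 0` the only set is empty and avoids everything.
open Classical in
theorem Dense.avoid {P : Finset V → Prop} (h : Dense G γ c P) {F : Finset V}
    (hF : (#F : ℝ) ≤ γ / 2 * #G) : Dense G (γ / 2) c fun S => P S ∧ Disjoint S F := by
  rcases c with _ | c
  · have : 0 ≤ γ / 2 * #G := le_trans (by positivity) hF
    by_cases hγ : γ ≤ 0
    · unfold Dense
      refine le_trans ?_ (Nat.cast_nonneg _)
      simpa using by linarith
    · refine h.mono (by linarith) fun S _ hS hP => ⟨hP, ?_⟩
      rw [card_eq_zero.1 hS]; simp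
  unfold Dense at *
  have h1 : (#{S ∈ G.powersetCard (c + 1) | P S} : ℝ) ≤
      #{S ∈ G.powersetCard (c + 1) | P S ∧ Disjoint S F} + #F * #G ^ c := by
    have h2 := card_filter_not_disjoint_le G F c
    have h3 : #{S ∈ G.powersetCard (c + 1) | P S} ≤
        #{S ∈ G.powersetCard (c + 1) | P S ∧ Disjoint S F} +
        #{S ∈ G.powersetCard (c + 1) | ¬ Disjoint S F} := by
      rw [← card_union_of_disjoint]
      · apply card_le_card
        intro S; simp only [mem_filter, mem_union]; tauto
      · rw [disjoint_left]; intro S; simp only [mem_filter]; tauto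
    exact_mod_cast h3.trans (by gcongr)
  have h4 : (#F : ℝ) * #G ^ c ≤ γ / 2 * #G ^ (c + 1) := by
    calc (#F : ℝ) * #G ^ c ≤ γ / 2 * #G * #G ^ c := by gcongr
      _ = _ := by ring
  have : γ * (#G : ℝ) ^ (c + 1) = γ / 2 * #G ^ (c + 1) + γ / 2 * #G ^ (c + 1) := by ring
  have h5 : γ / 2 * (#G : ℝ) ^ (c + 1) ≤ #{S ∈ G.powersetCard (c + 1) | P S ∧ Disjoint S F} := by
    linarith
  convert h5

open Classical in
/-- Disjoint unions of two kinds of sets that both have positive density have positive density. -/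
theorem Dense.join {P : Finset V → Prop} {Q : Finset V → Finset V → Prop}
    (hP : Dense G γ a P) (hδ : 0 ≤ δ)
    (hQ : ∀ S ⊆ G, #S = a → P S → Dense G δ b (Q S))
    (hdisj : ∀ S T, P S → Q S T → Disjoint S T) :
    Dense G (γ * δ / 2 ^ (a + b)) (a + b)
      fun U => ∃ S T, S ⊆ G ∧ T ⊆ G ∧ #S = a ∧ #T = b ∧ P S ∧ Q S T ∧ U = S ∪ T := by
  unfold Dense at *
  set X : Finset (Finset V × Finset V) :=
    {p ∈ G.powersetCard a ×ˢ G.powersetCard b | P p.1 ∧ Q p.1 p.2} with hX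
  have h1 : γ * δ * (#G : ℝ) ^ (a + b) ≤ #X := by
    have : (#X : ℝ) = ∑ S ∈ G.powersetCard a with P S, (#{T ∈ G.powersetCard b | Q S T} : ℝ) := by
      rw [hX, card_filter, sum_product, sum_filter]
      push_cast
      refine sum_congr rfl fun S _ => ?_
      by_cases hS : P S <;> simp [hS]
    rw [this]
    calc γ * δ * (#G : ℝ) ^ (a + b) = (γ * (#G : ℝ) ^ a) * (δ * #G ^ b) := by ring
      _ ≤ #{S ∈ G.powersetCard a | P S} * (δ * #G ^ b) := by gcongr
      _ = ∑ S ∈ G.powersetCard a with P S, (δ * (#G : ℝ) ^ b) := by simp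
      _ ≤ _ := by
        refine sum_le_sum fun S hS => ?_
        simp only [mem_filter, mem_powersetCard] at hS
        exact hQ S hS.1.1 hS.1.2 hS.2
  -- A union `U` arises from at most `2 ^ (a + b)` pairs: its subset `S` determines `T = U \ S` by
  -- disjointness.
  have h2 : #X ≤ 2 ^ (a + b) * #(X.image fun p => p.1 ∪ p.2) := by
    refine card_le_mul_card_image _ _ fun U hU => ?_
    have hUc : #U ≤ a + b := by
      obtain ⟨p, hp, rfl⟩ := mem_image.1 hU
      simp only [hX, mem_filter, mem_product, mem_powersetCard] at hp
      refine (card_union_le _ _).trans (by omega)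
    calc _ ≤ #(U.powerset) := by
          refine card_le_card_of_injOn Prod.fst ?_ ?_
          · intro p hp
            simp only [coe_filter, Set.mem_ofPred_eq] at hp
            simp only [coe_powerset, Set.mem_preimage, Set.mem_powerset_iff, coe_subset]
            rw [← hp.2]; exact subset_union_left
          · rintro ⟨S, T⟩ hp ⟨S', T'⟩ hp' (rfl : S = S')
            simp only [hX, coe_filter, Set.mem_ofPred_eq, mem_filter] at hp hp'
            have d1 := hdisj _ _ hp.1.2.1 hp.1.2.2
            have d2 := hdisj _ _ hp'.1.2.1 hp'.1.2.2
            have : T = T' := by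
              rw [← union_sdiff_cancel_left d1, ← union_sdiff_cancel_left d2, hp.2, hp'.2]
            rw [this]
      _ ≤ 2 ^ (a + b) := by rw [card_powerset]; gcongr; norm_num
  have h3 : (#(X.image fun p => p.1 ∪ p.2) : ℝ) ≤ #{U ∈ G.powersetCard (a + b) |
      ∃ S T, S ⊆ G ∧ T ⊆ G ∧ #S = a ∧ #T = b ∧ P S ∧ Q S T ∧ U = S ∪ T} := by
    gcongr
    intro U hU
    obtain ⟨⟨S, T⟩, hp, rfl⟩ := mem_image.1 hU
    simp only [hX, mem_filter, mem_product, mem_powersetCard] at hp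
    obtain ⟨⟨⟨h1, h2⟩, h3, h4⟩, h5, h6⟩ := hp
    simp only [mem_filter, mem_powersetCard]
    refine ⟨⟨union_subset h1 h3, ?_⟩, S, T, h1, h3, h2, h4, h5, h6, rfl⟩
    rw [card_union_of_disjoint (hdisj _ _ h5 h6), h2, h4]
  have h4 : (#X : ℝ) ≤ 2 ^ (a + b) * #(X.image fun p => p.1 ∪ p.2) := by exact_mod_cast h2
  rw [div_mul_eq_mul_div, div_le_iff₀ (by positivity)]
  calc _ ≤ _ := h1
    _ ≤ _ := h4
    _ ≤ _ := by rw [mul_comm]; gcongr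

/-- A version of `Dense.join` in which the disjointness of the two sets is arranged, and the
second set avoids a small set `F` as well. -/
theorem Dense.join_avoid {P : Finset V → Prop} {Q : Finset V → Finset V → Prop}
    (hP : Dense G γ a P) (hδ : 0 ≤ δ)
    (hQ : ∀ S ⊆ G, #S = a → P S → Dense G δ b (Q S)) {F : Finset V}
    (hF : (a + #F : ℝ) ≤ δ / 2 * #G) :
    Dense G (γ * (δ / 2) / 2 ^ (a + b)) (a + b)
      fun U => ∃ S T, S ⊆ G ∧ T ⊆ G ∧ #S = a ∧ #T = b ∧ P S ∧ Q S T ∧ Disjoint T S ∧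
        Disjoint T F ∧ U = S ∪ T := by
  have := hP.join (Q := fun S T => #S = a ∧ Q S T ∧ Disjoint T (S ∪ F)) (δ := δ / 2) (b := b)
    (by linarith) (fun S hS hSa hPS => ((hQ S hS hSa hPS).avoid (F := S ∪ F) ?_).mono le_rfl
      fun T _ _ hT => ⟨hSa, hT⟩)
    (fun S T _ hQ => (disjoint_union_right.1 hQ.2.2).1.symm)
  · refine this.mono le_rfl ?_
    rintro U - - ⟨S, T, h1, h2, h3, h4, h5, ⟨-, h6, h7⟩, h8⟩
    rw [disjoint_union_right] at h7
    exact ⟨S, T, h1, h2, h3, h4, h5, h6, h7.1, h7.2, h8⟩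
  · refine le_trans ?_ hF
    have := card_union_le S F
    rw [hSa] at this
    exact_mod_cast this

end Dense

universe u

theorem exists_forall_le_mul (C : ℝ) {δ : ℝ} (hδ : 0 < δ) :
    ∃ n₀ : ℕ, ∀ n : ℕ, n₀ ≤ n → C ≤ δ * n := by
  obtain ⟨n₀, h⟩ := exists_nat_ge (C / δ)
  refine ⟨n₀, fun n hn => ?_⟩
  rw [div_le_iff₀ hδ] at h
  have : (n₀ : ℝ) ≤ n := by exact_mod_cast hn
  nlinarith

/-! ### Reachability and ways to produce it -/

section Reach

variable {V : Type u} [DecidableEq V] {k : ℕ}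

/-- There are at least `γ n ^ c` sets of size `c` connecting `x` and `y`. -/
def Reach (H : UniformHypergraph V k) (γ : ℝ) (c : ℕ) (x y : V) : Prop :=
  Dense H.verts γ c (H.Connects {x} {y})

theorem Reach.anti {H : UniformHypergraph V k} {γ δ : ℝ} {c : ℕ} {x y : V}
    (h : H.Reach γ c x y) (hδ : δ ≤ γ) : H.Reach δ c x y :=
  Dense.mono h hδ fun _ _ _ h => h

end Reach

theorem dense_singleton {V : Type u} [DecidableEq V] {G : Finset V} {η : ℝ} {p : V → Prop}
    [DecidablePred p]
    (h : η * #G ≤ #{z ∈ G | p z}) : Dense G η 1 fun S => ∃ z, S = {z} ∧ p z := by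
  unfold Dense
  rw [pow_one]
  refine h.trans (Nat.cast_le.2 ?_)
  rw [← card_image_of_injective _ (singleton_injective (α := V))]
  refine card_le_card fun S hS => ?_
  obtain ⟨z, hz, rfl⟩ := mem_image.1 hS
  rw [mem_filter] at hz
  simp only [mem_filter, mem_powersetCard, singleton_subset_iff, card_singleton, and_true]
  exact ⟨hz.1, z, rfl, hz.2⟩

open Classical in
/-- If many vertices are reachable from both `x` and `y`, then `x` and `y` are reachable. -/
theorem exists_reach_of_common {γ η : ℝ} (hγ : 0 < γ) (hη : 0 < η) (k c : ℕ) :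
    ∃ γ' : ℝ, 0 < γ' ∧ ∃ n₀ : ℕ, ∀ {V : Type u} [DecidableEq V] (H : UniformHypergraph V k),
      n₀ ≤ #H.verts → ∀ x y : V,
        η * #H.verts ≤ #{z ∈ H.verts | H.Reach γ c x z ∧ H.Reach γ c z y} →
          H.Reach γ' (1 + c + c) x y := by
  obtain ⟨n₁, hn₁⟩ := exists_forall_le_mul 2 (half_pos hη)
  obtain ⟨n₂, hn₂⟩ := exists_forall_le_mul (1 + c + 2) (half_pos hγ)
  refine ⟨η / 2 * (γ / 2) / 2 ^ (1 + c) * (γ / 2) / 2 ^ (1 + c + c), by positivity,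
    max n₁ n₂, fun {V} _ H hn x y h => ?_⟩
  have h2 := hn₂ _ (le_of_max_le_right hn)
  have hxy : (#{x, y} : ℝ) ≤ 2 := by exact_mod_cast card_le_two
  have hc : (0 : ℝ) ≤ c := by positivity
  -- Choose in turn `z`, a set connecting `x` to `z`, and a set connecting `z` to `y`, each avoiding
  -- `x`, `y` and the earlier choices, so that `Connects.trans` applies. Each choice costs half of
  -- its density, each union a power of 2.
  have d1 := (dense_singleton h).avoid (F := {x, y}) (hxy.trans (hn₁ _ (le_of_max_le_left hn)))
  have d2 := d1.join_avoid (δ := γ) (b := c) (F := {x, y})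
    (Q := fun S T => ∃ z, S = {z} ∧ H.Connects {x} {z} T ∧ H.Reach γ c z y) hγ.le ?_ ?_
  · have d3 := d2.join_avoid (δ := γ) (b := c) (F := {x, y})
      (Q := fun W T => ∃ z U, W = {z} ∪ U ∧ H.Connects {x} {z} U ∧ z ≠ x ∧ z ≠ y ∧ y ∉ U ∧
        H.Connects {z} {y} T) hγ.le ?_ ?_
    · refine d3.mono le_rfl ?_
      rintro U - - ⟨W, T, -, -, -, -, -, ⟨z, U, rfl, h1, h2, h3, h4, h5⟩, h6, h7, rfl⟩
      simp only [disjoint_union_right, disjoint_insert_right, disjoint_singleton_right] at h6 h7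
      exact h1.trans h5 h6.2.symm h7.1 h4 h2.symm h3.symm
    · rintro W - - ⟨S, T, -, -, -, -, ⟨-, h1⟩, ⟨z, rfl, h2, h3⟩, -, h5, rfl⟩
      simp only [disjoint_insert_right, disjoint_singleton_right, mem_singleton] at h1 h5
      exact Dense.mono h3 le_rfl fun T' _ _ h =>
        ⟨z, T, rfl, h2, Ne.symm h1.1, Ne.symm h1.2, h5.2, h⟩
    · push_cast; linarith
  · rintro S - - ⟨⟨z, rfl, h1, h2⟩, -⟩
    exact Dense.mono h1 le_rfl fun T _ _ hT => ⟨z, rfl, hT, h2⟩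
  · push_cast; linarith

/-- Connecting sets may be enlarged by edges. -/
theorem exists_reach_add_edges {γ δ : ℝ} (hγ : 0 < γ) (hδ : 0 < δ) (k c j : ℕ) :
    ∃ γ' : ℝ, 0 < γ' ∧ ∃ n₀ : ℕ, ∀ {V : Type u} [DecidableEq V] (H : UniformHypergraph V k),
      n₀ ≤ #H.verts → Dense H.verts δ k (· ∈ H.edges) → ∀ x y : V,
        H.Reach γ c x y → H.Reach γ' (c + j * k) x y := by
  induction j with
  | zero => exact ⟨γ, hγ, 0, fun H _ _ x y h => by simpa using h⟩
  | succ j ih =>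
    obtain ⟨γ₁, hγ₁, n₁, h₁⟩ := ih
    obtain ⟨n₂, hn₂⟩ := exists_forall_le_mul (c + j * k + 2 : ℕ) (half_pos hδ)
    refine ⟨γ₁ * (δ / 2) / 2 ^ (c + j * k + k), by positivity, max n₁ n₂,
      fun {V} _ H hn hd x y h => ?_⟩
    -- A fresh edge, disjoint from `S`, `x` and `y`, adds `k` to the size of a connecting set
    -- without changing what it connects.
    have d := Dense.join_avoid (h₁ H (le_of_max_le_left hn) hd x y h) hδ.le
      (Q := fun _ e => e ∈ H.edges) (fun _ _ _ _ => hd) (F := {x, y}) ?_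
    · rw [show c + (j + 1) * k = c + j * k + k by ring]
      refine Dense.mono d le_rfl ?_
      rintro U - - ⟨S, e, -, -, -, -, h1, h2, h3, h4, rfl⟩
      simp only [disjoint_insert_right, disjoint_singleton_right] at h4
      exact h1.union_matchable (Matchable.edge h2) h3 (by simp [h4.1]) (by simp [h4.2])
    · refine le_trans ?_ (hn₂ _ (le_of_max_le_right hn))
      have : #{x, y} ≤ 2 := card_le_two
      exact_mod_cast (by omega)

/-- If the vertices of `X` and `Y` are matched up in reachable pairs, then many sets connect
`X` and `Y`. -/
theorem exists_dense_connects {γ : ℝ} (hγ : 0 < γ) (k c j : ℕ) :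
    ∃ γ' : ℝ, 0 < γ' ∧ ∃ n₀ : ℕ, ∀ {V : Type u} [DecidableEq V] (H : UniformHypergraph V k),
      n₀ ≤ #H.verts → ∀ (X Y : Finset V) (f : V → V), #X = j → Set.BijOn f X Y →
        (∀ x ∈ X, H.Reach γ c x (f x)) → Dense H.verts γ' (j * c) (H.Connects X Y) := by
  induction j with
  | zero =>
    refine ⟨1, one_pos, 0, fun {V} _ H _ X Y f hX hf _ => ?_⟩
    rw [card_eq_zero] at hX
    subst hX
    have hY : Y = ∅ := by
      rw [← coe_eq_empty, ← hf.image_eq]; simp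
    subst hY
    have : H.Connects ∅ ∅ ∅ := ⟨by simp, by simp, by simpa using Matchable.empty,
      by simpa using Matchable.empty⟩
    classical
    simp [Dense, filter_singleton, this]
  | succ j ih =>
    obtain ⟨γ₁, hγ₁, n₁, h₁⟩ := ih
    obtain ⟨n₂, hn₂⟩ := exists_forall_le_mul (2 : ℕ) (half_pos hγ₁)
    obtain ⟨n₃, hn₃⟩ := exists_forall_le_mul (j * c + (j + j) : ℕ) (half_pos hγ)
    refine ⟨γ₁ / 2 * (γ / 2) / 2 ^ (j * c + c), by positivity, max n₁ (max n₂ n₃),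
      fun {V} _ H hn X Y f hX hf hr => ?_⟩
    simp only [max_le_iff] at hn
    obtain ⟨x, X, hx, rfl, hXj⟩ := card_eq_succ.1 hX
    have hf' : Set.BijOn f X (Y.erase (f x)) := by
      have := hf.sdiff_singleton (a := x) (by simp)
      simpa [hx] using this
    have hY : insert (f x) (Y.erase (f x)) = Y := insert_erase (by
      have := hf.mapsTo (show x ∈ ((insert x X : Finset V) : Set V) by simp); simpa using this)
    have hYj : #(Y.erase (f x)) = j := by
      rw [← hXj]
      have := hf'.image_eq
      rw [← coe_image, coe_inj] at this
      rw [← this, card_image_of_injOn hf'.injOn]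
    -- The sets for `X` must avoid the new pair, and below the set for the new pair must avoid `X`
    -- and its partner; only then do the two combine by `Connects.union`.
    have d1 := (h₁ H hn.1 X (Y.erase (f x)) f hXj hf' fun z hz => hr z (by simp [hz])).avoid
      (F := {x, f x}) ?_
    · have d2 := d1.join_avoid (δ := γ) (b := c) (F := X ∪ Y.erase (f x)) hγ.le
        (Q := fun _ T => H.Connects {x} {f x} T) (fun _ _ _ _ => hr x (by simp)) ?_
      · rw [show (j + 1) * c = j * c + c by ring, insert_eq, ← hY, insert_eq,
          union_comm {x}, union_comm {f x}]
        refine d2.mono le_rfl ?_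
        rintro U - - ⟨S, T, -, -, -, -, ⟨h1, h2⟩, h3, h4, h5, rfl⟩
        simp only [disjoint_union_right, disjoint_insert_right, disjoint_singleton_right]
          at h2 h5
        exact h1.union h3 h4.symm (by simp [h2.1]) (by simp [h2.2]) h5.1 h5.2 (by simp [hx])
          (by simp)
      · refine le_trans ?_ (hn₃ _ hn.2.2)
        have := card_union_le X (Y.erase (f x))
        exact_mod_cast (by omega)
    · refine le_trans ?_ (hn₂ _ hn.2.1)
      exact_mod_cast card_le_two

/-! ### Links and exchange of link sets -/

section Link

variable {V : Type u} [DecidableEq V] {m : ℕ}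

/-- The link of `x`: the `m`-sets that form an edge together with `x`. -/
def link (H : UniformHypergraph V (m + 1)) (x : V) : Finset (Finset V) :=
  {T ∈ H.verts.powersetCard m | x ∉ T ∧ insert x T ∈ H.edges}

theorem mem_link {H : UniformHypergraph V (m + 1)} {x : V} {T : Finset V} :
    T ∈ H.link x ↔ x ∉ T ∧ insert x T ∈ H.edges := by
  refine ⟨fun h => (mem_filter.1 h).2, fun h => mem_filter.2 ⟨mem_powersetCard.2 ⟨?_, ?_⟩, h⟩⟩
  · exact (subset_insert _ _).trans (edge_subset h.2)
  · have := edge_card h.2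
    rw [card_insert_of_notMem h.1] at this
    omega

theorem card_filter_mem_edges (H : UniformHypergraph V (m + 1)) (x : V) :
    #{e ∈ H.edges | x ∈ e} = #(H.link x) := by
  refine card_bij' (fun e _ => e.erase x) (fun T _ => insert x T) ?_ ?_ ?_ ?_
  · intro e he
    rw [mem_filter] at he
    rw [mem_link, insert_erase he.2]
    exact ⟨notMem_erase _ _, he.1⟩
  · intro T hT
    rw [mem_link] at hT
    simp [hT.2]
  · intro e he
    rw [mem_filter] at he
    exact insert_erase he.2
  · intro T hT
    rw [mem_link] at hT
    exact erase_insert hT.1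

/-- A common link set of `x` and `y` is itself a connecting set, since either vertex completes it to
an edge. -/
theorem reach_of_link {H : UniformHypergraph V (m + 1)} {γ : ℝ} {x y : V}
    (h : γ * (#H.verts : ℝ) ^ m ≤ #(H.link x ∩ H.link y)) : H.Reach γ m x y := by
  classical
  unfold Reach Dense
  refine h.trans (Nat.cast_le.2 (card_le_card fun T hT => ?_))
  rw [mem_inter] at hT
  have h1 := mem_link.1 hT.1
  have h2 := mem_link.1 hT.2
  refine mem_filter.2 ⟨(mem_filter.1 hT.1).1, by simp [h1.1], by simp [h2.1], ?_, ?_⟩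
  · rw [union_comm, ← insert_eq]; exact Matchable.edge h1.2
  · rw [union_comm, ← insert_eq]; exact Matchable.edge h2.2

end Link

/-- If many link sets of `x` can be matched up with many link sets of `y` in reachable pairs,
then `x` and `y` are reachable. -/
theorem exists_reach_of_link {γ μ : ℝ} (hγ : 0 < γ) (hμ : 0 < μ) (m c : ℕ) :
    ∃ γ' : ℝ, 0 < γ' ∧ ∃ n₀ : ℕ, ∀ {V : Type u} [DecidableEq V]
      (H : UniformHypergraph V (m + 1)),
      n₀ ≤ #H.verts → ∀ (x y : V) (P Q : Finset V → Prop),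
        Dense H.verts μ m (fun T => T ∈ H.link x ∧ P T) →
        Dense H.verts μ m (fun T => T ∈ H.link y ∧ Q T) →
        (∀ T T', P T → Q T' → ∃ f : V → V, Set.BijOn f T T' ∧ ∀ u ∈ T, H.Reach γ c u (f u)) →
        H.Reach γ' (m + m + m * c) x y := by
  obtain ⟨γ₁, hγ₁, n₁, h₁⟩ := exists_dense_connects hγ (m + 1) c m
  obtain ⟨n₂, hn₂⟩ := exists_forall_le_mul (2 : ℕ) (half_pos hμ)
  obtain ⟨n₃, hn₃⟩ := exists_forall_le_mul (m + 2 : ℕ) (half_pos hμ)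
  obtain ⟨n₄, hn₄⟩ := exists_forall_le_mul (m + m + 2 : ℕ) (half_pos hγ₁)
  refine ⟨μ / 2 * (μ / 2) / 2 ^ (m + m) * (γ₁ / 2) / 2 ^ (m + m + m * c), by positivity,
    max (max n₁ n₂) (max n₃ n₄), fun {V} _ H hn x y P Q hx hy hPQ => ?_⟩
  simp only [max_le_iff] at hn
  have hxy : #{x, y} ≤ 2 := card_le_two
  -- Choose a link set `T` of `x`, a disjoint link set `T'` of `y`, and then a set of size `m * c`
  -- connecting `T` to `T'`; `Connects.transfer` turns the three into a set connecting `x` and `y`.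
  have d1 := hx.avoid (F := {x, y}) ?_
  · have d2 := d1.join_avoid (δ := μ) (b := m) (F := {x, y}) hμ.le
      (Q := fun _ T => T ∈ H.link y ∧ Q T) (fun _ _ _ _ => hy) ?_
    · have d3 := d2.join_avoid (δ := γ₁) (b := m * c) (F := {x, y}) hγ₁.le
        (Q := fun W U => ∃ T T', W = T ∪ T' ∧ H.Connects T T' U ∧ T ∈ H.link x ∧ T' ∈ H.link y ∧
          Disjoint T' T ∧ y ∉ T ∧ x ∉ T') ?_ ?_
      · refine Dense.mono d3 le_rfl ?_
        rintro U - - ⟨W, U, -, -, -, -, -, ⟨T, T', rfl, h1, h2, h3, h4, h5, h6⟩, h7, h8, rfl⟩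
        simp only [disjoint_insert_right, disjoint_singleton_right] at h8
        rw [mem_link] at h2 h3
        exact h1.transfer h2.2 h3.2 h2.1 h3.1 h4 h6 h5 h8.1 h8.2
      · rintro W - - ⟨T, T', -, -, hT, -, ⟨⟨h1, h2⟩, h3⟩, ⟨h4, h5⟩, h6, h7, rfl⟩
        simp only [disjoint_insert_right, disjoint_singleton_right] at h3 h7
        obtain ⟨f, hf, hr⟩ := hPQ T T' h2 h5
        exact (h₁ H hn.1.1 T T' f hT hf hr).mono le_rfl fun U _ _ hU =>
          ⟨T, T', rfl, hU, h1, h4, h6, h3.2, h7.1⟩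
      · refine le_trans ?_ (hn₄ _ hn.2.2)
        exact_mod_cast (by omega)
    · refine le_trans ?_ (hn₃ _ hn.2.1)
      exact_mod_cast (by omega)
  · refine le_trans ?_ (hn₂ _ hn.1.2)
    exact_mod_cast hxy

theorem exists_bijOn_of_card_eq {α β : Type*} [Nonempty β] {S : Finset α} {T : Finset β}
    (h : #S = #T) : ∃ f : α → β, Set.BijOn f S T := by
  classical
  obtain ⟨b⟩ := ‹Nonempty β›
  let e := Finset.equivOfCardEq h
  refine ⟨fun v => if hv : v ∈ S then e ⟨v, hv⟩ else b, ?_, ?_, ?_⟩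
  · intro v hv
    have hv' : v ∈ S := hv
    simp [hv']
  · intro v hv w hw hvw
    have hv' : v ∈ S := hv
    have hw' : w ∈ S := hw
    simp only [hv', hw', dite_true] at hvw
    exact congrArg Subtype.val (e.injective (Subtype.ext hvw))
  · intro w hw
    refine ⟨e.symm ⟨w, hw⟩, by simp, by simp⟩

theorem exists_bijOn_union {α β : Type*} [Nonempty β] {S₁ S₂ : Finset α}
    {T₁ T₂ : Finset β} (h₁ : #S₁ = #T₁) (h₂ : #S₂ = #T₂) (hS : Disjoint S₁ S₂)
    (hT : Disjoint T₁ T₂) :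
    ∃ f : α → β, Set.BijOn f S₁ T₁ ∧ Set.BijOn f S₂ T₂ ∧
      Set.BijOn f (S₁ ∪ S₂ : Set α) (T₁ ∪ T₂ : Set β) := by
  classical
  obtain ⟨f, hf⟩ := exists_bijOn_of_card_eq h₁
  obtain ⟨g, hg⟩ := exists_bijOn_of_card_eq h₂
  have h1 : Set.BijOn (fun v => if v ∈ S₁ then f v else g v) S₁ T₁ :=
    hf.congr fun v hv => (if_pos hv).symm
  have h2 : Set.BijOn (fun v => if v ∈ S₁ then f v else g v) S₂ T₂ :=
    hg.congr fun v hv => (if_neg (disjoint_right.1 hS hv)).symm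
  refine ⟨_, h1, h2, h1.union h2 ?_⟩
  rw [Set.injOn_union (by exact_mod_cast hS)]
  refine ⟨h1.injOn, h2.injOn, fun x hx y hy hxy => ?_⟩
  have := h1.mapsTo hx
  rw [hxy] at this
  exact disjoint_left.1 hT this (h2.mapsTo hy)

theorem Dense.le_one {V : Type u} [DecidableEq V] {G : Finset V} {γ : ℝ} {c : ℕ}
    {P : Finset V → Prop} (h : Dense G γ c P) (hG : 0 < #G) : γ ≤ 1 := by
  classical
  have h1 : (0 : ℝ) < #G := by exact_mod_cast hG
  have h2 : γ * (#G : ℝ) ^ c ≤ 1 * (#G : ℝ) ^ c := by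
    rw [one_mul]
    exact le_trans h (by exact_mod_cast (card_filter_le _ _).trans (card_powersetCard_le_pow G c))
  exact le_of_mul_le_mul_right h2 (by positivity)

/-! ### Absorbers and the absorbing matching -/

section Absorb

variable {V : Type u} [DecidableEq V] {k : ℕ}

/-- `S` is an absorber for `Q`. -/
def Absorber (H : UniformHypergraph V k) (Q S : Finset V) : Prop :=
  Disjoint S Q ∧ H.Matchable (S ∪ Q)

theorem matchable_biUnion {H : UniformHypergraph V k} {F : Finset (Finset V)}
    (hF : (F : Set (Finset V)).PairwiseDisjoint id) (hM : ∀ S ∈ F, H.Matchable S) :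
    H.Matchable (F.biUnion id) := by
  induction F using Finset.induction_on with
  | empty => simpa using Matchable.empty
  | insert S F hS ih =>
    rw [biUnion_insert]
    refine (hM S (by simp)).union (ih (hF.subset (by simp)) fun T hT => hM T (by simp [hT])) ?_
    rw [disjoint_biUnion_right]
    exact fun T hT => hF (by simp) (by simp [hT]) (by rintro rfl; exact hS hT)

open Classical in
/-- A family of disjoint absorbers that contains `r` absorbers for every `k`-subset of `W` absorbs
`W` if `W` has `r * k` elements. -/
theorem matchable_biUnion_union {H : UniformHypergraph V k} {r : ℕ} :
    ∀ {F : Finset (Finset V)} {W : Finset V}, (F : Set (Finset V)).PairwiseDisjoint id →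
    (∀ S ∈ F, H.Matchable S) → #W = r * k → Disjoint (F.biUnion id) W →
    (∀ Q ⊆ W, #Q = k → r ≤ #{S ∈ F | H.Absorber Q S}) → H.Matchable (F.biUnion id ∪ W) := by
  induction r with
  | zero =>
    intro F W hF hM hW _ _
    have : W = ∅ := by simpa using hW
    rw [this, union_empty]
    exact matchable_biUnion hF hM
  | succ r ih =>
    intro F W hF hM hW hd hits
    -- Split off one `k`-set `Q` and spend one of its absorbers `S` on it. Every other `k`-set loses
    -- at most the absorber `S`, so `r` remain for the `r` blocks that are left.
    obtain ⟨Q, hQW, hQ⟩ := exists_subset_card_eq (s := W) (n := k) (by rw [hW]; nlinarith)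
    obtain ⟨S, hS⟩ := card_pos.1 (lt_of_lt_of_le (Nat.succ_pos r) (hits Q hQW hQ))
    obtain ⟨hSF, hSQ, hSm⟩ := mem_filter.1 hS
    have e1 : F.biUnion id = S ∪ (F.erase S).biUnion id := by
      conv_lhs => rw [← insert_erase hSF, biUnion_insert]
      rfl
    have d1 : Disjoint S ((F.erase S).biUnion id) := by
      rw [disjoint_biUnion_right]
      intro T hT
      rw [mem_erase] at hT
      exact hF hSF hT.2 (Ne.symm hT.1)
    rw [e1, disjoint_union_left] at hd
    have h1 := @ih (F.erase S) (W \ Q) (hF.subset (by simp)) (fun T hT => hM T (mem_of_mem_erase hT))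
      (by rw [card_sdiff_of_subset hQW, hW, hQ]; rw [add_mul, one_mul, Nat.add_sub_cancel])
      (hd.2.mono_right sdiff_subset)
      (fun Q' hQ' hc => by
        have := hits Q' (hQ'.trans sdiff_subset) hc
        have h2 : #{T ∈ F | H.Absorber Q' T} ≤ #{T ∈ F.erase S | H.Absorber Q' T} + 1 := by
          rw [filter_erase]
          have := pred_card_le_card_erase (s := {T ∈ F | H.Absorber Q' T}) (a := S)
          omega
        omega)
    rw [e1, show S ∪ (F.erase S).biUnion id ∪ W = (S ∪ Q) ∪ ((F.erase S).biUnion id ∪ W \ Q) by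
      rw [union_union_union_comm, union_sdiff_of_subset hQW]]
    refine hSm.union h1 ?_
    rw [disjoint_union_left, disjoint_union_right, disjoint_union_right]
    exact ⟨⟨d1, hd.1.mono_right sdiff_subset⟩, (hd.2.mono_right hQW).symm, disjoint_sdiff⟩

end Absorb

open Classical in
/-- If each of the properties `Abs q` is dense, then one can choose `N` disjoint sets
such that each of the properties holds for many of them. -/
theorem exists_disjoint_family {V : Type u} [DecidableEq V] {ι : Type*} {G : Finset V} {γ : ℝ}
    {c : ℕ} (hγ : 0 < γ) (hc : 0 < c) (I : Finset ι) (P : Finset V → Prop)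
    (Abs : ι → Finset V → Prop) (h : ∀ q ∈ I, Dense G γ c fun S => P S ∧ Abs q S) (N : ℕ)
    (hN : (N * c : ℝ) ≤ γ / 2 * #G) :
    ∃ F : Finset (Finset V), #F ≤ N ∧ (∀ S ∈ F, S ⊆ G ∧ #S = c ∧ P S) ∧
      (F : Set (Finset V)).PairwiseDisjoint id ∧
      ∑ q ∈ I, (1 / 2 : ℝ) ^ #{S ∈ F | Abs q S} ≤ #I * (1 - γ / 4) ^ N := by
  -- A derandomised choice: `q` carries the weight `2 ^ (-hits)`, where the hits are the chosen sets
  -- with `Abs q`. At each step some candidate reduces the total weight by the factor `1 - γ / 4`.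
  induction N with
  | zero => exact ⟨∅, by simp⟩
  | succ N ih =>
    have hc' : (1 : ℝ) ≤ c := by exact_mod_cast hc
    push_cast at hN
    obtain ⟨F, hFN, hF, hFd, hsum⟩ := ih (by nlinarith)
    rcases I.eq_empty_or_nonempty with rfl | ⟨q₀, hq₀⟩
    · exact ⟨F, by omega, hF, hFd, by simp⟩
    have hn : (0 : ℝ) < #G := by
      by_contra hn
      have : (0 : ℝ) ≤ N := by positivity
      nlinarith
    have hγ1 : γ ≤ 1 := (h q₀ hq₀).le_one (by exact_mod_cast hn)
    set U := F.biUnion id with hU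
    have hUc : (#U : ℝ) ≤ γ / 2 * #G := by
      have : #U ≤ #F * c := card_biUnion_le_card_mul _ _ _ fun S hS => (hF S hS).2.1.le
      have h2 : (#U : ℝ) ≤ N * c := by exact_mod_cast this.trans (by gcongr)
      nlinarith
    set A : Finset (Finset V) := {S ∈ G.powersetCard c | P S ∧ Disjoint S U} with hA
    have hAq : ∀ q ∈ I, γ / 2 * (#G : ℝ) ^ c ≤ #{S ∈ A | Abs q S} := by
      intro q hq
      refine ((h q hq).avoid hUc).trans (Nat.cast_le.2 (card_le_card fun S hS => ?_))
      simp only [hA, mem_filter] at hS ⊢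
      tauto
    have hAle : (#A : ℝ) ≤ (#G : ℝ) ^ c := by
      exact_mod_cast (card_filter_le _ _).trans (card_powersetCard_le_pow G c)
    have hAne : A.Nonempty := by
      have : (0 : ℝ) < #{S ∈ A | Abs q₀ S} := lt_of_lt_of_le (by positivity) (hAq q₀ hq₀)
      obtain ⟨S, hS⟩ := card_pos.1 (Nat.cast_pos.1 this)
      exact ⟨S, (mem_filter.1 hS).1⟩
    set w : ι → ℝ := fun q => (1 / 2 : ℝ) ^ #{S ∈ F | Abs q S} with hw
    have hw0 : ∀ q, 0 ≤ w q := fun q => by positivity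
    -- Averaging over the candidates: at least a proportion `γ / 2` of them, those disjoint from the
    -- vertices used so far, hit a given `q` and halve its weight.
    have key : ∑ S ∈ A, ∑ q ∈ I, w q * (if Abs q S then 1 / 2 else 1) ≤
        ∑ S ∈ A, (1 - γ / 4) * ∑ q ∈ I, w q := by
      rw [sum_comm, sum_const, nsmul_eq_mul, mul_sum, mul_sum]
      refine sum_le_sum fun q hq => ?_
      have e : ∑ S ∈ A, w q * (if Abs q S then 1 / 2 else 1) =
          w q * (#A - #{S ∈ A | Abs q S} / 2) := by
        rw [← mul_sum]
        congr 1
        have : ∀ S, (if Abs q S then 1 / 2 else 1 : ℝ) = 1 - (if Abs q S then 1 else 0) / 2 := by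
          intro S; split_ifs <;> norm_num
        simp_rw [this, sum_sub_distrib, ← sum_div, card_filter]
        simp
      rw [e, show (#A : ℝ) * ((1 - γ / 4) * w q) = w q * (#A - γ / 4 * #A) by ring]
      have := hAq q hq
      refine mul_le_mul_of_nonneg_left ?_ (hw0 q)
      nlinarith
    obtain ⟨S, hSA, hS⟩ := exists_le_of_sum_le hAne key
    have hSA' := mem_filter.1 hSA
    rw [mem_powersetCard] at hSA'
    have hSF : S ∉ F := by
      intro hS
      have : Disjoint S S := hSA'.2.2.mono_right (subset_biUnion_of_mem id hS)
      rw [disjoint_self_iff_empty] at this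
      rw [this] at hSA'
      simp at hSA'
      omega
    refine ⟨insert S F, ?_, ?_, ?_, ?_⟩
    · rw [card_insert_of_notMem hSF]; omega
    · intro T hT
      rcases mem_insert.1 hT with rfl | hT
      · exact ⟨hSA'.1.1, hSA'.1.2, hSA'.2.1⟩
      · exact hF T hT
    · rw [coe_insert]
      refine hFd.insert fun T hT _ => ?_
      exact hSA'.2.2.mono_right (subset_biUnion_of_mem id hT)
    · calc ∑ q ∈ I, (1 / 2 : ℝ) ^ #{T ∈ insert S F | Abs q T}
          = ∑ q ∈ I, w q * (if Abs q S then 1 / 2 else 1) := by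
            refine sum_congr rfl fun q _ => ?_
            rw [filter_insert]
            split_ifs with hq
            · rw [card_insert_of_notMem (by simp [hSF]), pow_succ]
            · rw [mul_one]
        _ ≤ (1 - γ / 4) * ∑ q ∈ I, w q := hS
        _ ≤ (1 - γ / 4) * (#I * (1 - γ / 4) ^ N) := by gcongr; linarith
        _ = _ := by ring

/-- This lets the exponential decay of the weights beat the number of `k`-sets, which is at most `n
^ k`. -/
theorem exists_forall_pow_lt_exp (k : ℕ) {κ : ℝ} (hκ : 0 < κ) :
    ∃ n₀ : ℕ, ∀ n : ℕ, n₀ ≤ n → (n : ℝ) ^ k < Real.exp (κ * n) := by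
  have h1 := Real.tendsto_pow_mul_exp_neg_atTop_nhds_zero k
  have h2 : Filter.Tendsto (fun n : ℕ => κ * (n : ℝ)) Filter.atTop Filter.atTop :=
    tendsto_natCast_atTop_atTop.const_mul_atTop hκ
  have h3 := (h1.comp h2).eventually_lt_const (show (0 : ℝ) < κ ^ k by positivity)
  obtain ⟨n₀, h⟩ := Filter.eventually_atTop.1 h3
  refine ⟨n₀, fun n hn => ?_⟩
  have := h n hn
  simp only [Function.comp_apply, mul_pow, Real.exp_neg] at this
  rw [← div_eq_mul_inv, div_lt_iff₀ (Real.exp_pos _)] at this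
  exact lt_of_mul_lt_mul_left this (by positivity)

/-- If every `k`-set has a positive density of absorbers, then there is a small matching that
absorbs every sufficiently small set of vertices. -/
theorem exists_absorbing_matching {γ : ℝ} (hγ : 0 < γ) {c k : ℕ} (hc : 0 < c) (hk : 0 < k) :
    ∃ ξ : ℝ, 0 < ξ ∧ ∃ n₀ : ℕ, ∀ {V : Type u} [DecidableEq V] (H : UniformHypergraph V k),
      n₀ ≤ #H.verts →
      (∀ Q ⊆ H.verts, #Q = k → Dense H.verts γ c fun S => H.Matchable S ∧ H.Absorber Q S) →
      ∃ M : Finset (Finset V), H.IsMatching M ∧ (#M : ℝ) ≤ ξ * #H.verts / k ∧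
        ∀ W : Finset V, W ⊆ H.verts \ support M → k ∣ #W → (#W : ℝ) ≤ ξ ^ 2 * #H.verts →
          H.Absorbs M W := by
  classical
  have hc' : (1 : ℝ) ≤ c := by exact_mod_cast hc
  have hk' : (1 : ℝ) ≤ k := by exact_mod_cast hk
  -- About `ξ n / c` disjoint sets of size `c` cover at most `ξ n` vertices. Each `k`-set will get
  -- at least `γ N / 8` absorbers, and `N ≥ ξ n / (2 c)` makes this at least `γ ξ n / (16 c) = ξ ^ 2
  -- n`, enough for all blocks of `W`.
  set ξ := γ / (16 * c) with hξ
  have hξ0 : 0 < ξ := by positivity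
  have hξc : ξ * (16 * c) = γ := by rw [hξ]; field_simp
  obtain ⟨n₁, hn₁⟩ := exists_forall_pow_lt_exp k (show 0 < γ * ξ / (16 * c) by positivity)
  obtain ⟨n₂, hn₂⟩ := exists_forall_le_mul (2 * c) hξ0
  refine ⟨ξ, hξ0, max n₁ n₂, fun {V} _ H hn hQ => ?_⟩
  have hn1 := hn₁ _ (le_of_max_le_left hn)
  have hn2 := hn₂ _ (le_of_max_le_right hn)
  set n := #H.verts with hndef
  have hn0 : (0 : ℝ) ≤ n := by positivity
  set N := ⌊ξ * n / c⌋₊ with hNdef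
  have hN1 : (N : ℝ) * c ≤ ξ * n := by
    rw [← le_div_iff₀ (by positivity)]
    exact Nat.floor_le (by positivity)
  have hN2 : ξ * n ≤ N * (2 * c) := by
    have h1 : ξ * n / c < N + 1 := Nat.lt_floor_add_one _
    rw [div_lt_iff₀ (by positivity)] at h1
    linarith
  obtain ⟨F, hFN, hF, hFd, hsum⟩ := exists_disjoint_family hγ hc (H.verts.powersetCard k)
    H.Matchable H.Absorber (fun Q hQ' => hQ Q (mem_powersetCard.1 hQ').1 (mem_powersetCard.1 hQ').2)
    N (hN1.trans (by gcongr; nlinarith))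
  have hits : ∀ Q ⊆ H.verts, #Q = k → γ * N / 8 ≤ #{S ∈ F | H.Absorber Q S} := by
    intro Q hQV hQk
    -- Otherwise the weight of `Q` alone would exceed `exp (-γ N / 8)`, while the total weight is at
    -- most `n ^ k exp (-γ N / 4)`, which is smaller for large `n`.
    by_contra! hlt
    have hmem : Q ∈ H.verts.powersetCard k := mem_powersetCard.2 ⟨hQV, hQk⟩
    set h := #{S ∈ F | H.Absorber Q S} with hh
    have s1 : Real.exp (-(γ * N / 8)) < Real.exp (-h) := Real.exp_lt_exp.2 (by linarith)
    have s2 : Real.exp (-h) ≤ (1 / 2 : ℝ) ^ h := by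
      have : Real.exp (-(h : ℝ)) = Real.exp (-1) ^ h := by rw [← Real.exp_nat_mul]; ring_nf
      rw [this]
      gcongr
      rw [Real.exp_neg, one_div]
      gcongr
      have := Real.add_one_le_exp 1
      linarith
    have s3 : (1 / 2 : ℝ) ^ h ≤ ∑ Q ∈ H.verts.powersetCard k, (1 / 2 : ℝ) ^ #{S ∈ F | H.Absorber Q S} :=
      single_le_sum (f := fun Q => (1 / 2 : ℝ) ^ #{S ∈ F | H.Absorber Q S})
        (fun _ _ => by positivity) hmem
    have s4 : (#(H.verts.powersetCard k) : ℝ) ≤ n ^ k := by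
      exact_mod_cast card_powersetCard_le_pow _ _
    have hγ1 : γ ≤ 1 := (hQ Q hQV hQk).le_one (by
      have hnpos : (0 : ℝ) < n := by nlinarith
      exact_mod_cast hnpos)
    have s5 : (1 - γ / 4) ^ N ≤ Real.exp (-(γ * N / 4)) := by
      have : Real.exp (-(γ * N / 4)) = Real.exp (-(γ / 4)) ^ N := by
        rw [← Real.exp_nat_mul]; ring_nf
      rw [this]
      have h6 := Real.add_one_le_exp (-(γ / 4))
      gcongr
      · linarith
      · linarith
    have s6 : (n : ℝ) ^ k < Real.exp (γ * N / 8) := by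
      refine hn1.trans_le (Real.exp_le_exp.2 ?_)
      rw [div_mul_eq_mul_div, div_le_div_iff₀ (by positivity) (by positivity)]
      nlinarith [mul_le_mul_of_nonneg_left hN2 hγ.le]
    have s7 : Real.exp (-(γ * N / 8)) < n ^ k * Real.exp (-(γ * N / 4)) := by
      calc _ < _ := s1
        _ ≤ _ := s2
        _ ≤ _ := s3
        _ ≤ _ := hsum
        _ ≤ n ^ k * (1 - γ / 4) ^ N := mul_le_mul_of_nonneg_right s4 (pow_nonneg (by linarith) _)
        _ ≤ _ := by gcongr
    have s8 : n ^ k * Real.exp (-(γ * N / 4)) <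
        Real.exp (γ * N / 8) * Real.exp (-(γ * N / 4)) := by gcongr
    rw [← Real.exp_add] at s8
    refine lt_irrefl _ (s7.trans (s8.trans_eq ?_))
    congr 1; ring
  obtain ⟨M, hM, hMF⟩ := matchable_biUnion hFd fun S hS => (hF S hS).2.2
  refine ⟨M, hM, ?_, fun W hW hkW hWξ => ?_⟩
  · rw [le_div_iff₀ (by positivity)]
    have h1 : k * #M ≤ N * c := by
      rw [← hM.card_support, hMF]
      exact (card_biUnion_le_card_mul _ _ _ fun S hS => (hF S hS).2.1.le).trans (by gcongr)
    have h2 : (k : ℝ) * #M ≤ N * c := by exact_mod_cast h1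
    linarith
  · have hWV : W ⊆ H.verts := hW.trans sdiff_subset
    have hWM : Disjoint (support M) W := (disjoint_sdiff.mono_right hW)
    obtain ⟨r, hr⟩ := hkW
    have hrN : (r : ℝ) ≤ γ * N / 8 := by
      have h1 : (#W : ℝ) = k * r := by rw [hr]; push_cast; rfl
      have h2 : (r : ℝ) ≤ k * r := by
        have : (0 : ℝ) ≤ r := by positivity
        nlinarith
      have h3 : ξ ^ 2 * n ≤ γ * N / 8 := by
        have : ξ * (ξ * n) ≤ ξ * (N * (2 * c)) := by gcongr
        rw [← hξc]
        nlinarith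
      linarith
    rw [hMF] at hWM
    have hmat := matchable_biUnion_union (r := r) (W := W) hFd (fun S hS => (hF S hS).2.2)
      (by rw [hr, mul_comm]) hWM
      (fun Q hQW hQk => by exact_mod_cast hrN.trans (hits Q (hQW.trans hWV) hQk))
    rw [← hMF] at hmat
    have hmat0 : H.Matchable (support M) := ⟨M, hM, rfl⟩
    exact ⟨hM, hmat0.subset, hWV, hmat0.exists_isPerfectMatching, hmat.exists_isPerfectMatching⟩

/-- If any two vertices are reachable, then every `k`-set has a positive density of absorbers. -/
theorem exists_dense_absorber {γ δ : ℝ} (hγ : 0 < γ) (hδ : 0 < δ) (k c : ℕ) :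
    ∃ γ' : ℝ, 0 < γ' ∧ ∃ n₀ : ℕ, ∀ {V : Type u} [DecidableEq V] (H : UniformHypergraph V k),
      n₀ ≤ #H.verts → Dense H.verts δ k (· ∈ H.edges) →
      (∀ x ∈ H.verts, ∀ y ∈ H.verts, H.Reach γ c x y) →
      ∀ Q ⊆ H.verts, #Q = k →
        Dense H.verts γ' (k + k * c) fun S => H.Matchable S ∧ H.Absorber Q S := by
  obtain ⟨γ₁, hγ₁, n₁, h₁⟩ := exists_dense_connects hγ k c k
  obtain ⟨n₂, hn₂⟩ := exists_forall_le_mul (k : ℕ) (half_pos hδ)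
  obtain ⟨n₃, hn₃⟩ := exists_forall_le_mul (k + k : ℕ) (half_pos hγ₁)
  refine ⟨δ / 2 * (γ₁ / 2) / 2 ^ (k + k * c), by positivity, max n₁ (max n₂ n₃),
    fun {V} _ H hn hd hr Q hQ hQk => ?_⟩
  simp only [max_le_iff] at hn
  -- The absorber is an edge `e` disjoint from `Q` together with a set `U` connecting `Q` to `e`.
  -- Without `Q` one uses the matching of `U ∪ e`; with `Q` one uses the edge `e` and the matching
  -- of `U ∪ Q`.
  have d1 := hd.avoid (F := Q) (by rw [hQk]; exact hn₂ _ hn.2.1)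
  have d2 := d1.join_avoid (δ := γ₁) (b := k * c) (F := Q) hγ₁.le
    (Q := fun e U => H.Connects Q e U) ?_ (by rw [hQk]; exact_mod_cast hn₃ _ hn.2.2)
  · refine d2.mono le_rfl ?_
    rintro S - - ⟨e, U, -, -, -, -, ⟨h1, h2⟩, h3, h4, h5, rfl⟩
    have he := Matchable.edge h1
    refine ⟨?_, ?_, ?_⟩
    · rw [union_comm]; exact h3.matchable_right
    · rw [disjoint_union_left]; exact ⟨h2, h5⟩
    · rw [union_assoc]
      exact he.union h3.matchable_left (by rw [disjoint_union_right]; exact ⟨h4.symm, h2⟩)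
  · rintro e he hek -
    have : Nonempty V ∨ Q = ∅ := Q.eq_empty_or_nonempty.symm.imp (fun ⟨x, _⟩ => ⟨x⟩) id
    obtain ⟨f, hf⟩ : ∃ f : V → V, Set.BijOn f Q e := by
      rcases this with h | rfl
      · exact exists_bijOn_of_card_eq (hQk.trans hek.symm)
      · have : e = ∅ := by rw [← card_eq_zero, hek, ← hQk, card_empty]
        exact ⟨id, by simp [this]⟩
    exact h₁ H hn.1 Q e f hQk hf fun x hx => hr x (hQ hx) _ (he (hf.mapsTo hx))

/-! ### Vertex degrees and large links -/

section Degree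

variable {V : Type u} [DecidableEq V] {m : ℕ} {H : UniformHypergraph V (m + 1)}

theorem minDegree_le_degree {k l : ℕ} (H : UniformHypergraph V k) {S : Finset V}
    (hS : S ⊆ H.verts) (hl : #S = l) : H.minDegree l ≤ H.degree S :=
  Nat.sInf_le ⟨S, hS, hl, rfl⟩

/-- A lower bound on the minimum `l`-degree gives the corresponding lower bound on vertex
degrees. -/
theorem le_card_link {l : ℕ} (hl : 1 ≤ l) (hlm : l ≤ m) {θ : ℝ}
    (h : θ * ((#H.verts - l).choose (m + 1 - l) : ℝ) ≤ H.minDegree l) {x : V}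
    (hx : x ∈ H.verts) : θ * ((#H.verts - 1).choose m : ℝ) ≤ #(H.link x) := by
  obtain ⟨l, rfl⟩ : ∃ l', l = l' + 1 := ⟨l - 1, by omega⟩
  -- Double counting of pairs of an `l`-set `S` avoiding `x` and an edge containing `S` and `x`,
  -- where `l` has been lowered by one. The identity `hid` cancels the binomials, so the factor `θ`
  -- survives unchanged.
  have hcount : ∑ S ∈ (H.verts.erase x).powersetCard l, H.degree (insert x S) =
      #(H.link x) * m.choose l := by
    have h1 : ∀ S ∈ (H.verts.erase x).powersetCard l, H.degree (insert x S) =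
        #{e ∈ {e ∈ H.edges | x ∈ e} | S ⊆ e} := by
      intro S _
      rw [degree, filter_filter]
      simp only [insert_subset_iff]
    rw [sum_congr rfl h1, ← card_filter_mem_edges]
    have := sum_card_bipartiteAbove_eq_sum_card_bipartiteBelow
      (s := (H.verts.erase x).powersetCard l) (t := {e ∈ H.edges | x ∈ e}) (fun S e => S ⊆ e)
    simp only [bipartiteAbove, bipartiteBelow] at this
    rw [this, sum_congr rfl (g := fun _ => m.choose l), sum_const, smul_eq_mul]
    intro e he
    rw [mem_filter] at he
    have he' : {S ∈ (H.verts.erase x).powersetCard l | S ⊆ e} = (e.erase x).powersetCard l := by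
      ext S
      simp only [mem_filter, mem_powersetCard, subset_erase]
      have := edge_subset he.1
      exact ⟨fun h => ⟨⟨h.2, h.1.1.2⟩, h.1.2⟩, fun h => ⟨⟨⟨h.1.1.trans this, h.1.2⟩, h.2⟩, h.1.1⟩⟩
    rw [he', card_powersetCard, card_erase_of_mem he.2, edge_card he.1, Nat.add_sub_cancel]
  set n := #H.verts with hn
  have hlow : (n - 1).choose l * (θ * ((n - (l + 1)).choose (m + 1 - (l + 1)) : ℝ)) ≤
      #(H.link x) * m.choose l := by
    calc (n - 1).choose l * (θ * ((n - (l + 1)).choose (m + 1 - (l + 1)) : ℝ))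
        = ∑ S ∈ (H.verts.erase x).powersetCard l,
            θ * ((n - (l + 1)).choose (m + 1 - (l + 1)) : ℝ) := by
          rw [sum_const, card_powersetCard, card_erase_of_mem hx, nsmul_eq_mul]
      _ ≤ ∑ S ∈ (H.verts.erase x).powersetCard l, (H.degree (insert x S) : ℝ) := by
          refine sum_le_sum fun S hS => h.trans (Nat.cast_le.2 ?_)
          rw [mem_powersetCard, subset_erase] at hS
          exact H.minDegree_le_degree (insert_subset hx hS.1.1)
            (by rw [card_insert_of_notMem hS.1.2, hS.2])
      _ = _ := by exact_mod_cast hcount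
  have hid : (n - 1).choose m * m.choose l =
      (n - 1).choose l * (n - (l + 1)).choose (m + 1 - (l + 1)) := by
    rw [Nat.choose_mul (by omega), show n - 1 - l = n - (l + 1) by omega,
      show m + 1 - (l + 1) = m - l by omega]
  have hid' : ((n - 1).choose m : ℝ) * m.choose l =
      (n - 1).choose l * (n - (l + 1)).choose (m + 1 - (l + 1)) := by exact_mod_cast hid
  have hpos : (0 : ℝ) < m.choose l := by exact_mod_cast Nat.choose_pos (by omega)
  refine le_of_mul_le_mul_right ?_ hpos
  calc θ * ((n - 1).choose m : ℝ) * m.choose l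
      = θ * (((n - 1).choose m : ℝ) * m.choose l) := by ring
    _ = (n - 1).choose l * (θ * ((n - (l + 1)).choose (m + 1 - (l + 1)) : ℝ)) := by
        rw [hid']; ring
    _ ≤ _ := hlow

theorem card_powersetCard_le_div (G : Finset V) (m : ℕ) :
    (#(G.powersetCard m) : ℝ) ≤ (#G : ℝ) ^ m / m.factorial := by
  rw [card_powersetCard]
  exact Nat.choose_le_pow_div m _

/-- The binomial is at least `(n - m) ^ m / m!`, and Bernoulli's inequality gives `(1 - m / n) ^ m ≥
1 - m ^ 2 / n`. Link sizes are measured against `n ^ m / m!` from here on. -/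
theorem exists_forall_le_choose_pred (m : ℕ) {τ : ℝ} (hτ : 0 < τ) :
    ∃ n₀ : ℕ, ∀ n : ℕ, n₀ ≤ n → (1 - τ) * ((n : ℝ) ^ m / m.factorial) ≤ (n - 1).choose m := by
  obtain ⟨n₁, hn₁⟩ := exists_forall_le_mul (m * m : ℕ) hτ
  refine ⟨max n₁ (m + 1), fun n hn => ?_⟩
  have h1 := hn₁ n (le_of_max_le_left hn)
  have h2 := le_of_max_le_right hn
  have hn0 : (0 : ℝ) < n := by exact_mod_cast (by omega : 0 < n)
  have h3 := Nat.pow_sub_le_descFactorial (n - 1) m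
  rw [Nat.descFactorial_eq_factorial_mul_choose, show n - 1 + 1 - m = n - m by omega] at h3
  have h4 : ((n : ℝ) - m) ^ m ≤ m.factorial * (n - 1).choose m := by
    rw [← Nat.cast_sub (by omega)]
    exact_mod_cast h3
  have h5 : 1 + (m : ℝ) * (-(m / n)) ≤ (1 + -(m / n)) ^ m := by
    refine one_add_mul_le_pow ?_ m
    have : (m : ℝ) / n ≤ 1 := by
      rw [div_le_one hn0]
      exact_mod_cast (by omega)
    linarith
  have h6 : ((n : ℝ) - m) ^ m = n ^ m * (1 + -(m / n)) ^ m := by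
    rw [← mul_pow]; congr 1; field_simp; ring
  have h7 : (m : ℝ) * (m / n) ≤ τ := by
    rw [← mul_div_assoc, div_le_iff₀ hn0]
    exact_mod_cast h1
  rw [mul_div_assoc', div_le_iff₀ (by positivity)]
  calc (1 - τ) * (n : ℝ) ^ m ≤ n ^ m * (1 + -(m / n)) ^ m := by
        rw [mul_comm]
        gcongr
        linarith
    _ ≤ _ := by rw [← h6, mul_comm]; linarith [h4]

/-- Every vertex degree is at least `(1/2 - τ) n ^ m / m!`. -/
def HasLargeLinks (H : UniformHypergraph V (m + 1)) (τ : ℝ) : Prop :=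
  ∀ x ∈ H.verts, (1 / 2 - τ) * ((#H.verts : ℝ) ^ m / m.factorial) ≤ #(H.link x)

/-- The degrees sum to `(m + 1)` times the number of edges, and each is at least a quarter of `n ^ m
/ m!`. -/
theorem HasLargeLinks.dense_edges {τ : ℝ} (h : H.HasLargeLinks τ) (hτ : τ ≤ 1 / 4) :
    Dense H.verts (1 / (4 * (m + 1).factorial)) (m + 1) (· ∈ H.edges) := by
  classical
  have h1 : ∑ x ∈ H.verts, #(H.link x) = (m + 1) * #H.edges := by
    simp_rw [← card_filter_mem_edges]
    have := sum_card_bipartiteAbove_eq_sum_card_bipartiteBelow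
      (s := H.verts) (t := H.edges) (fun x e => x ∈ e)
    simp only [bipartiteAbove, bipartiteBelow] at this
    rw [this, sum_congr rfl (g := fun _ => m + 1), sum_const, smul_eq_mul, mul_comm]
    intro e he
    rw [filter_mem_eq_inter, inter_eq_right.2 (edge_subset he), edge_card he]
  have h2 : (#H.verts : ℝ) * (1 / 4 * ((#H.verts : ℝ) ^ m / m.factorial)) ≤
      (m + 1) * #H.edges := by
    calc (#H.verts : ℝ) * (1 / 4 * ((#H.verts : ℝ) ^ m / m.factorial))
        = ∑ x ∈ H.verts, (1 / 4 * ((#H.verts : ℝ) ^ m / m.factorial)) := by simp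
      _ ≤ ∑ x ∈ H.verts, (#(H.link x) : ℝ) := by
          refine sum_le_sum fun x hx => le_trans ?_ (h x hx)
          gcongr
          linarith
      _ = _ := by exact_mod_cast h1
  have h4 : 1 / (4 * (m + 1).factorial) * (#H.verts : ℝ) ^ (m + 1) ≤ #H.edges := by
    rw [Nat.factorial_succ]
    push_cast
    refine le_of_mul_le_mul_left (le_of_eq_of_le ?_ h2) (by positivity : (0 : ℝ) < m + 1)
    field_simp
    ring
  exact Dense.of_subset h4 fun e he => ⟨⟨edge_subset he, edge_card he⟩, he⟩

/-- Among any three vertices two have many common link sets. -/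
theorem HasLargeLinks.three {τ : ℝ} (h : H.HasLargeLinks τ) (hτ : τ ≤ 1 / 12) {x y z : V}
    (hx : x ∈ H.verts) (hy : y ∈ H.verts) (hz : z ∈ H.verts) :
    1 / (12 * m.factorial) * (#H.verts : ℝ) ^ m ≤ #(H.link x ∩ H.link y) ∨
    1 / (12 * m.factorial) * (#H.verts : ℝ) ^ m ≤ #(H.link y ∩ H.link z) ∨
    1 / (12 * m.factorial) * (#H.verts : ℝ) ^ m ≤ #(H.link x ∩ H.link z) := by
  have hsub : ∀ x, H.link x ⊆ H.verts.powersetCard m := fun x => filter_subset _ _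
  have h1 := card_union_add_card_inter (H.link x) (H.link y)
  have h2 := card_union_add_card_inter (H.link x ∪ H.link y) (H.link z)
  have h3 : #((H.link x ∪ H.link y) ∩ H.link z) ≤
      #(H.link x ∩ H.link z) + #(H.link y ∩ H.link z) := by
    rw [union_inter_distrib_right]; exact card_union_le _ _
  have h4 : #(H.link x ∪ H.link y ∪ H.link z) ≤ #(H.verts.powersetCard m) :=
    card_le_card (union_subset (union_subset (hsub x) (hsub y)) (hsub z))
  -- Three links of relative size at least `1 / 2 - 1 / 12` have total size `5 / 4`; the excess `1 /
  -- 4` is shared by three pairs, so one pair has overlap at least `1 / 12`.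
  have h5 : #(H.link x) + #(H.link y) + #(H.link z) ≤ #(H.verts.powersetCard m) +
      #(H.link x ∩ H.link y) + #(H.link x ∩ H.link z) + #(H.link y ∩ H.link z) := by omega
  have h6 : (#(H.link x) : ℝ) + #(H.link y) + #(H.link z) ≤ #(H.verts.powersetCard m) +
      #(H.link x ∩ H.link y) + #(H.link x ∩ H.link z) + #(H.link y ∩ H.link z) := by
    exact_mod_cast h5
  have h7 := card_powersetCard_le_div H.verts m
  have hx := h x hx
  have hy := h y hy
  have hz := h z hz
  rw [show 1 / (12 * (m.factorial : ℝ)) * (#H.verts : ℝ) ^ m =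
    ((#H.verts : ℝ) ^ m / m.factorial) / 12 by field_simp]
  set N := (#H.verts : ℝ) ^ m / m.factorial with hN
  have hN0 : 0 ≤ N := by positivity
  by_contra! hcon
  obtain ⟨c1, c2, c3⟩ := hcon
  have : (1 / 2 - 1 / 12) * N ≤ (1 / 2 - τ) * N := by gcongr
  linarith

end Degree

/-! ### Two classes of link-close vertices, and index sets of links -/

section Structure

variable {V : Type u} [DecidableEq V] {m : ℕ} {H : UniformHypergraph V (m + 1)}

/-- The vertices `x` and `y` have at least `β n ^ m` common link sets. -/
def LinkClose (H : UniformHypergraph V (m + 1)) (β : ℝ) (x y : V) : Prop :=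
  β * (#H.verts : ℝ) ^ m ≤ #(H.link x ∩ H.link y)

theorem LinkClose.symm {β : ℝ} {x y : V} (h : H.LinkClose β x y) : H.LinkClose β y x := by
  unfold LinkClose at *
  rwa [inter_comm]

open Classical in
/-- Either any two vertices are link-close or have many common link-close vertices, or the
vertices can almost be covered by two disjoint sets of pairwise link-close vertices. -/
theorem HasLargeLinks.exists_partition {τ η : ℝ} (h : H.HasLargeLinks τ) (hτ : τ ≤ 1 / 12)
    {β : ℝ} (hβ : β = 1 / (12 * m.factorial)) :
    (∀ x ∈ H.verts, ∀ y ∈ H.verts, H.LinkClose β x y ∨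
      η * #H.verts ≤ #{z ∈ H.verts | H.LinkClose β x z ∧ H.LinkClose β z y}) ∨
    ∃ A B : Finset V, A ⊆ H.verts ∧ B ⊆ H.verts ∧ Disjoint A B ∧
      (#(H.verts \ (A ∪ B)) : ℝ) ≤ η * #H.verts ∧
      (∀ a ∈ A, ∀ b ∈ A, H.LinkClose β a b) ∧ ∀ a ∈ B, ∀ b ∈ B, H.LinkClose β a b := by
  subst hβ
  rw [or_iff_not_imp_left]
  intro hcon
  push Not at hcon
  obtain ⟨x, hx, y, hy, hxy, hlt⟩ := hcon
  have clique : ∀ x ∈ H.verts, ∀ a ∈ H.verts, ∀ b ∈ H.verts,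
      ¬ H.LinkClose (1 / (12 * m.factorial)) x a → ¬ H.LinkClose (1 / (12 * m.factorial)) x b →
      H.LinkClose (1 / (12 * m.factorial)) a b := by
    intro x hx a ha b hb h1 h2
    rcases h.three hτ hx ha hb with h3 | h3 | h3
    · exact absurd h3 h1
    · exact h3
    · exact absurd h3 h2
  -- The classes are the non-neighbours of `x` and those of `y`, where `x`, `y` are not link-close
  -- and have few common neighbours. A vertex in both classes would form with `x` and `y` three
  -- pairwise non-close vertices, and a vertex in neither is a common neighbour.
  refine ⟨{z ∈ H.verts | ¬ H.LinkClose (1 / (12 * m.factorial)) x z},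
    {z ∈ H.verts | ¬ H.LinkClose (1 / (12 * m.factorial)) y z}, filter_subset _ _,
    filter_subset _ _, ?_, ?_, ?_, ?_⟩
  · rw [disjoint_left]
    intro z hz hz'
    rw [mem_filter] at hz hz'
    exact hxy (clique z hz.1 x hx y hy (fun h => hz.2 h.symm) fun h => hz'.2 h.symm)
  · refine le_trans (Nat.cast_le.2 (card_le_card fun z hz => ?_)) hlt.le
    simp only [mem_sdiff, mem_union, mem_filter, not_or, not_and, not_not] at hz ⊢
    exact ⟨hz.1, hz.2.1 hz.1, (hz.2.2 hz.1).symm⟩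
  · intro a ha b hb
    rw [mem_filter] at ha hb
    exact clique x hx a ha.1 b hb.1 ha.2 hb.2
  · intro a ha b hb
    rw [mem_filter] at ha hb
    exact clique y hy a ha.1 b hb.1 ha.2 hb.2

/-- The `m`-sets in `C` whose intersection with `A` has its size in `K`. -/
def slice (G A C : Finset V) (m : ℕ) (K : Finset ℕ) : Finset (Finset V) :=
  {T ∈ G.powersetCard m | T ⊆ C ∧ #(T ∩ A) ∈ K}

theorem mem_slice {G A C : Finset V} {K : Finset ℕ} {T : Finset V} :
    T ∈ slice G A C m K ↔ (T ⊆ G ∧ #T = m) ∧ T ⊆ C ∧ #(T ∩ A) ∈ K := by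
  rw [slice, mem_filter, mem_powersetCard]

open Classical in
/-- The sizes `i` such that many link sets of `z` lie in `C` and meet `A` in `i` vertices. -/
noncomputable def linkIndices (H : UniformHypergraph V (m + 1)) (A C : Finset V) (μ : ℝ) (z : V) :
    Finset ℕ :=
  {i ∈ range (m + 1) | μ * (#H.verts : ℝ) ^ m ≤ #(H.link z ∩ slice H.verts A C m {i})}

end Structure

/-- Two sets with the same number of vertices in each of two classes can be matched up within the
classes. -/
theorem exists_bijOn_of_card_inter_eq {V : Type u} [DecidableEq V] {A B T T' : Finset V}
    (hT : T ⊆ A ∪ B) (hT' : T' ⊆ A ∪ B) (h : #T = #T') (hA : #(T ∩ A) = #(T' ∩ A)) :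
    ∃ f : V → V, Set.BijOn f T T' ∧
      ∀ u ∈ T, (u ∈ A ∧ f u ∈ A) ∨ (u ∈ B ∧ f u ∈ B) := by
  rcases T.eq_empty_or_nonempty with rfl | ⟨v, -⟩
  · have : T' = ∅ := by rw [← card_eq_zero, ← h, card_empty]
    exact ⟨id, by simp [this]⟩
  have : Nonempty V := ⟨v⟩
  have h1 := card_sdiff_add_card_inter T A
  have h2 := card_sdiff_add_card_inter T' A
  obtain ⟨f, hf1, hf2, hf⟩ := exists_bijOn_union hA (S₂ := T \ A) (T₂ := T' \ A) (by omega)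
    (disjoint_sdiff_inter T A).symm (disjoint_sdiff_inter T' A).symm
  rw [← coe_union, ← coe_union, union_comm, sdiff_union_inter, union_comm, sdiff_union_inter] at hf
  refine ⟨f, hf, fun u hu => ?_⟩
  by_cases huA : u ∈ A
  · exact Or.inl ⟨huA, (mem_inter.1 (hf1.mapsTo (mem_inter.2 ⟨hu, huA⟩))).2⟩
  · have h3 := mem_sdiff.1 (hf2.mapsTo (mem_sdiff.2 ⟨hu, huA⟩))
    have h4 := mem_union.1 (hT hu)
    have h5 := mem_union.1 (hT' h3.1)
    exact Or.inr ⟨h4.resolve_left huA, h5.resolve_left h3.2⟩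

open Classical in
/-- Either any two vertices are reachable, or there is a partition of almost all the vertices
into two classes of pairwise link-close vertices such that two vertices have links of
different types, and few vertices have links of a mixed type. -/
theorem exists_reach_or_partition (m : ℕ) {η μ β : ℝ} (hη : 0 < η) (hμ : 0 < μ)
    (hβ : β = 1 / (12 * m.factorial)) :
    ∃ γ : ℝ, 0 < γ ∧ ∃ n₀ : ℕ, ∀ {V : Type u} [DecidableEq V]
      (H : UniformHypergraph V (m + 1)), n₀ ≤ #H.verts → ∀ τ : ℝ, τ ≤ 1 / 12 →
      H.HasLargeLinks τ →
      (∀ x ∈ H.verts, ∀ y ∈ H.verts,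
        H.Reach γ (1 + (m + m + m * m) + (m + m + m * m)) x y) ∨
      ∃ A B : Finset V, A ⊆ H.verts ∧ B ⊆ H.verts ∧ Disjoint A B ∧
        (#(H.verts \ (A ∪ B)) : ℝ) ≤ η * #H.verts ∧
        (∀ a ∈ A, ∀ b ∈ A, H.LinkClose β a b) ∧ (∀ a ∈ B, ∀ b ∈ B, H.LinkClose β a b) ∧
        ∃ x ∈ H.verts, ∃ y ∈ H.verts,
          Disjoint (H.linkIndices A (A ∪ B) μ x) (H.linkIndices A (A ∪ B) μ y) ∧
          (#{z ∈ H.verts | ¬ Disjoint (H.linkIndices A (A ∪ B) μ x)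
              (H.linkIndices A (A ∪ B) μ z) ∧ ¬ Disjoint (H.linkIndices A (A ∪ B) μ z)
              (H.linkIndices A (A ∪ B) μ y)} : ℝ) ≤ η * #H.verts := by
  have hβ0 : 0 < β := by rw [hβ]; positivity
  have hδ : (0 : ℝ) < 1 / (4 * (m + 1).factorial) := by positivity
  -- There are four ways to reach `y` from `x`: a common link set, a common link-close vertex, a
  -- common index, or a vertex sharing an index with each. The first three are padded by edges to
  -- the size that the last one produces.
  obtain ⟨γ₁, hγ₁, n₁, h₁⟩ := exists_reach_of_common.{u} hβ0 hη (m + 1) m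
  obtain ⟨γ₂, hγ₂, n₂, h₂⟩ := exists_reach_add_edges.{u} hβ0 hδ (m + 1) m 1
  obtain ⟨γ₃, hγ₃, n₃, h₃⟩ := exists_reach_add_edges.{u} (lt_min hγ₁ hγ₂) hδ (m + 1)
    (1 + m + m) (2 * m)
  obtain ⟨γ₄, hγ₄, n₄, h₄⟩ := exists_reach_of_link.{u} hβ0 hμ m m
  obtain ⟨γ₅, hγ₅, n₅, h₅⟩ := exists_reach_of_common.{u} hγ₄ hη (m + 1) (m + m + m * m)
  obtain ⟨γ₆, hγ₆, n₆, h₆⟩ := exists_reach_add_edges.{u} hγ₄ hδ (m + 1) (m + m + m * m) (m + 1)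
  refine ⟨min γ₃ (min γ₅ γ₆), by positivity, max (max (max n₁ n₂) (max n₃ n₄)) (max n₅ n₆),
    fun {V} _ H hn τ hτ hL => ?_⟩
  simp only [max_le_iff] at hn
  obtain ⟨⟨⟨hn1, hn2⟩, hn3, hn4⟩, hn5, hn6⟩ := hn
  have hd := hL.dense_edges (by linarith)
  rcases hL.exists_partition (η := η) hτ hβ with hall | ⟨A, B, hA, hB, hAB, hC, hcA, hcB⟩
  · left
    intro x hx y hy
    refine Reach.anti ?_ (min_le_left _ _)
    rw [show 1 + (m + m + m * m) + (m + m + m * m) = 1 + m + m + 2 * m * (m + 1) by ring]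
    refine h₃ H hn3 hd x y ?_
    rcases hall x hx y hy with h | h
    · refine Reach.anti ?_ (min_le_right _ _)
      have := h₂ H hn2 hd x y (reach_of_link h)
      rwa [show m + 1 * (m + 1) = 1 + m + m by ring] at this
    · refine Reach.anti ?_ (min_le_left _ _)
      refine h₁ H hn1 x y (h.trans (Nat.cast_le.2 (card_le_card fun z hz => ?_)))
      rw [mem_filter] at hz ⊢
      exact ⟨hz.1, reach_of_link hz.2.1, reach_of_link hz.2.2⟩
  · rw [or_iff_not_imp_right]
    intro hcon
    -- If `i` is frequent for both vertices, many link sets of each lie in `A ∪ B` and have `i`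
    -- vertices in `A`. Any two such sets can be matched up within the classes, where all pairs are
    -- link-close and hence reachable.
    have trans : ∀ x y, ¬ Disjoint (H.linkIndices A (A ∪ B) μ x) (H.linkIndices A (A ∪ B) μ y) →
        H.Reach γ₄ (m + m + m * m) x y := by
      intro x y hxy
      obtain ⟨i, hix, hiy⟩ := not_disjoint_iff.1 hxy
      have hi : ∀ x, i ∈ H.linkIndices A (A ∪ B) μ x → Dense H.verts μ m fun T =>
          T ∈ H.link x ∧ T ⊆ A ∪ B ∧ #T = m ∧ #(T ∩ A) = i := by
        intro x hix
        refine Dense.of_subset (mem_filter.1 hix).2 fun T hT => ?_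
        rw [mem_inter, mem_slice, mem_singleton] at hT
        exact ⟨hT.2.1, hT.1, hT.2.2.1, hT.2.1.2, hT.2.2.2⟩
      refine h₄ H hn4 x y _ _ (hi x hix) (hi y hiy) ?_
      rintro T T' ⟨h1, h2, h3⟩ ⟨h1', h2', h3'⟩
      obtain ⟨f, hf, hfc⟩ := exists_bijOn_of_card_inter_eq h1 h1' (h2.trans h2'.symm)
        (h3.trans h3'.symm)
      refine ⟨f, hf, fun u hu => ?_⟩
      rcases hfc u hu with h | h
      · exact reach_of_link (hcA u h.1 _ h.2)
      · exact reach_of_link (hcB u h.1 _ h.2)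
    intro x hx y hy
    by_cases hxy : Disjoint (H.linkIndices A (A ∪ B) μ x) (H.linkIndices A (A ∪ B) μ y)
    · refine Reach.anti ?_ ((min_le_right _ _).trans (min_le_left _ _))
      by_contra hnr
      refine hcon ⟨A, B, hA, hB, hAB, hC, hcA, hcB, x, hx, y, hy, hxy, ?_⟩
      by_contra! hlt
      refine hnr (h₅ H hn5 x y (hlt.le.trans (Nat.cast_le.2 (card_le_card fun z hz => ?_))))
      rw [mem_filter] at hz ⊢
      exact ⟨hz.1, trans _ _ hz.2.1, trans _ _ hz.2.2⟩
    · refine Reach.anti ?_ ((min_le_right _ _).trans (min_le_right _ _))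
      have := h₆ H hn6 hd x y (trans x y hxy)
      rwa [show m + m + m * m + (m + 1) * (m + 1) =
        1 + (m + m + m * m) + (m + m + m * m) by ring] at this

/-! ### Links described by slices -/

section Types

variable {V : Type u} [DecidableEq V] {m : ℕ} {H : UniformHypergraph V (m + 1)}

theorem link_subset (H : UniformHypergraph V (m + 1)) (x : V) :
    H.link x ⊆ H.verts.powersetCard m := filter_subset _ _

theorem slice_subset (G A C : Finset V) (m : ℕ) (K : Finset ℕ) :
    slice G A C m K ⊆ G.powersetCard m := filter_subset _ _

theorem disjoint_slice (G A C : Finset V) (m : ℕ) {I J : Finset ℕ} (h : Disjoint I J) :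
    Disjoint (slice G A C m I) (slice G A C m J) := by
  rw [disjoint_left]
  intro T hT hT'
  exact disjoint_left.1 h (mem_slice.1 hT).2.2 (mem_slice.1 hT').2.2

theorem pow_eq_factorial_mul (n m : ℕ) :
    (n : ℝ) ^ m = m.factorial * ((n : ℝ) ^ m / m.factorial) := by
  field_simp

theorem card_mul_pow_le {n m s : ℕ} {η : ℝ} (hm : 1 ≤ m) (hs : (s : ℝ) ≤ η * n) :
    (s : ℝ) * n ^ (m - 1) ≤ η * n ^ m := by
  obtain ⟨m, rfl⟩ : ∃ m', m = m' + 1 := ⟨m - 1, by omega⟩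
  rw [Nat.add_sub_cancel, pow_succ']
  calc (s : ℝ) * n ^ m ≤ η * n * n ^ m := by gcongr
    _ = _ := by ring

open Classical in
theorem card_filter_not_disjoint_le_mul {G F : Finset V} {η : ℝ} (hm : 1 ≤ m)
    (hF : (#F : ℝ) ≤ η * #G) :
    (#{S ∈ G.powersetCard m | ¬ Disjoint S F} : ℝ) ≤ η * (#G : ℝ) ^ m := by
  refine le_trans ?_ (card_mul_pow_le hm hF)
  have := card_filter_not_disjoint_le G F (m - 1)
  rw [Nat.sub_add_cancel hm] at this
  exact_mod_cast this

/-- Almost all link sets of `z` have an intersection with `A` of one of the frequent sizes. -/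
theorem card_link_sdiff_slice_le {A C : Finset V} {η μ : ℝ} (hm : 1 ≤ m)
    (hC : (#(H.verts \ C) : ℝ) ≤ η * #H.verts) (hμ : 0 ≤ μ) (z : V) :
    (#(H.link z \ slice H.verts A C m (H.linkIndices A C μ z)) : ℝ) ≤
      (η + (m + 1) * μ) * (#H.verts : ℝ) ^ m := by
  classical
  set I := H.linkIndices A C μ z with hI
  -- A link set outside the slice either leaves `C`, which happens for at most `η n ^ m` sets, or
  -- has one of at most `m + 1` infrequent indices, each contributing less than `μ n ^ m`.
  have hsub : H.link z \ slice H.verts A C m I ⊆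
      {S ∈ H.verts.powersetCard m | ¬ Disjoint S (H.verts \ C)} ∪
      (range (m + 1) \ I).biUnion fun i => H.link z ∩ slice H.verts A C m {i} := by
    intro T hT
    rw [mem_sdiff, mem_slice] at hT
    have hT1 := mem_powersetCard.1 (H.link_subset z hT.1)
    rw [mem_union, mem_filter, mem_powersetCard, mem_biUnion]
    by_cases hTC : T ⊆ C
    · right
      have hi : #(T ∩ A) ∉ I := fun h => hT.2 ⟨hT1, hTC, h⟩
      refine ⟨#(T ∩ A), mem_sdiff.2 ⟨mem_range.2 ?_, hi⟩, mem_inter.2 ⟨hT.1, mem_slice.2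
        ⟨hT1, hTC, mem_singleton_self _⟩⟩⟩
      have := card_le_card (inter_subset_left : T ∩ A ⊆ T)
      omega
    · left
      refine ⟨hT1, fun hd => hTC fun v hv => ?_⟩
      by_contra hvC
      exact disjoint_left.1 hd hv (mem_sdiff.2 ⟨hT1.1 hv, hvC⟩)
  have h1 := (card_le_card hsub).trans (card_union_le _ _)
  have h2 := card_filter_not_disjoint_le_mul (m := m) hm hC
  have h3 : (#((range (m + 1) \ I).biUnion fun i => H.link z ∩ slice H.verts A C m {i}) : ℝ) ≤
      (m + 1) * (μ * (#H.verts : ℝ) ^ m) := by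
    calc (#((range (m + 1) \ I).biUnion fun i => H.link z ∩ slice H.verts A C m {i}) : ℝ)
        ≤ ∑ i ∈ range (m + 1) \ I, (#(H.link z ∩ slice H.verts A C m {i}) : ℝ) := by
          exact_mod_cast card_biUnion_le
      _ ≤ ∑ i ∈ range (m + 1) \ I, μ * (#H.verts : ℝ) ^ m := by
          refine sum_le_sum fun i hi => ?_
          rw [mem_sdiff, hI, linkIndices, mem_filter, not_and, not_le] at hi
          exact (hi.2 hi.1).le
      _ = #(range (m + 1) \ I) * (μ * (#H.verts : ℝ) ^ m) := by rw [sum_const, nsmul_eq_mul]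
      _ ≤ _ := by
          have : #(range (m + 1) \ I) ≤ m + 1 := (card_le_card sdiff_subset).trans_eq (card_range _)
          gcongr
          exact_mod_cast this
  have h4 : (#(H.link z \ slice H.verts A C m I) : ℝ) ≤
      #{S ∈ H.verts.powersetCard m | ¬ Disjoint S (H.verts \ C)} +
      #((range (m + 1) \ I).biUnion fun i => H.link z ∩ slice H.verts A C m {i}) := by
    exact_mod_cast h1
  linarith

/-- If the links of two vertices have disjoint sets of frequent indices, then these two sets
describe half of the `m`-sets each, and every link that has no index in common with one of them is
described by the other one. -/
theorem HasLargeLinks.card_symmDiff_le {A C : Finset V} {τ η μ θ κ : ℝ} (h : H.HasLargeLinks τ)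
    (hm : 1 ≤ m) (hC : (#(H.verts \ C) : ℝ) ≤ η * #H.verts) (hμ : 0 ≤ μ) (hτ : 0 ≤ τ)
    (hθ : (η + (m + 1) * μ) * m.factorial ≤ θ) (hθ0 : 0 ≤ θ) (hκ : 7 * (τ + θ) ≤ κ) {x y : V}
    (hx : x ∈ H.verts) (hy : y ∈ H.verts)
    (hxy : Disjoint (H.linkIndices A C μ x) (H.linkIndices A C μ y)) :
    (1 / 2 - κ) * ((#H.verts : ℝ) ^ m / m.factorial) ≤
      #(slice H.verts A C m (H.linkIndices A C μ x)) ∧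
    ∀ z ∈ H.verts, Disjoint (H.linkIndices A C μ z) (H.linkIndices A C μ y) →
      (#(symmDiff (H.link z) (slice H.verts A C m (H.linkIndices A C μ x))) : ℝ) ≤
        κ * ((#H.verts : ℝ) ^ m / m.factorial) := by
  have hsd := fun z => card_link_sdiff_slice_le (H := H) (A := A) hm hC hμ z
  have hall := card_powersetCard_le_div H.verts m
  rw [pow_eq_factorial_mul] at hsd
  set N := (#H.verts : ℝ) ^ m / m.factorial with hN
  have hN0 : 0 ≤ N := by positivity
  have hsd' : ∀ z, (#(H.link z \ slice H.verts A C m (H.linkIndices A C μ z)) : ℝ) ≤ θ * N := by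
    intro z
    refine (hsd z).trans ?_
    rw [← mul_assoc]
    gcongr
  have hlow : ∀ z ∈ H.verts, (1 / 2 - τ - θ) * N ≤
      #(H.link z ∩ slice H.verts A C m (H.linkIndices A C μ z)) := by
    intro z hz
    have h1 := card_sdiff_add_card_inter (H.link z) (slice H.verts A C m (H.linkIndices A C μ z))
    have h2 : (#(H.link z \ slice H.verts A C m (H.linkIndices A C μ z)) : ℝ) +
        #(H.link z ∩ slice H.verts A C m (H.linkIndices A C μ z)) = #(H.link z) := by
      exact_mod_cast h1
    have := h z hz
    have := hsd' z
    linarith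
  have hslice : ∀ z ∈ H.verts, (1 / 2 - τ - θ) * N ≤
      #(slice H.verts A C m (H.linkIndices A C μ z)) := fun z hz =>
    (hlow z hz).trans (Nat.cast_le.2 (card_le_card inter_subset_right))
  have hκN : 7 * (τ + θ) * N ≤ κ * N := by gcongr
  refine ⟨?_, fun z hz hzy => ?_⟩
  · have := hslice x hx
    nlinarith
  set I := H.linkIndices A C μ x
  set J := H.linkIndices A C μ y
  set W := slice H.verts A C m I
  set W' := slice H.verts A C m J
  have hW' := hslice y hy
  have hW := hslice x hx
  -- Both slices have size at least `(1 / 2 - τ - θ) N` and are disjoint, so at most `2 (τ + θ) N`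
  -- sets lie in neither. Since the link of `z` has at most `θ N` sets in `W'`, at most `(2 τ + 3 θ)
  -- N` lie outside `W`; comparing sizes bounds `W \ H.link z` by `(4 τ + 4 θ) N`. The total is `(6
  -- τ + 7 θ) N`, whence the factor 7.
  have hWW' : (#W : ℝ) + #W' ≤ N := by
    refine le_trans ?_ hall
    rw [← Nat.cast_add, ← card_union_of_disjoint (disjoint_slice _ _ _ _ hxy)]
    exact Nat.cast_le.2 (card_le_card (union_subset (slice_subset _ _ _ _ _)
      (slice_subset _ _ _ _ _)))
  have h1 : (#(H.link z ∩ W') : ℝ) ≤ θ * N := by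
    refine le_trans (Nat.cast_le.2 (card_le_card ?_)) (hsd' z)
    intro T hT
    rw [mem_inter] at hT
    exact mem_sdiff.2 ⟨hT.1, disjoint_right.1 (disjoint_slice _ _ _ _ hzy) hT.2⟩
  have h2 : (#(H.link z \ W) : ℝ) ≤ #(H.link z ∩ W') + (#(H.verts.powersetCard m) - #W - #W') := by
    have : #(H.link z \ W) + #W + #W' ≤ #(H.link z ∩ W') + #(H.verts.powersetCard m) := by
      have e1 : H.link z \ W ⊆ (H.link z ∩ W') ∪ (H.verts.powersetCard m \ (W ∪ W')) := by
        intro T hT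
        rw [mem_sdiff] at hT
        simp only [mem_union, mem_inter, mem_sdiff]
        have := H.link_subset z hT.1
        tauto
      have e2 := (card_le_card e1).trans (card_union_le _ _)
      have e3 : #(H.verts.powersetCard m \ (W ∪ W')) + #(W ∪ W') = #(H.verts.powersetCard m) :=
        card_sdiff_add_card_eq_card (union_subset (slice_subset _ _ _ _ _)
          (slice_subset _ _ _ _ _))
      have e4 : #(W ∪ W') = #W + #W' := card_union_of_disjoint (disjoint_slice _ _ _ _ hxy)
      omega
    have h3 : (#(H.link z \ W) : ℝ) + #W + #W' ≤
      #(H.link z ∩ W') + #(H.verts.powersetCard m) := by exact_mod_cast this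
    linarith
  have h3 : (#(W \ H.link z) : ℝ) + #(H.link z) = #W + #(H.link z \ W) := by
    have e1 := card_sdiff_add_card_inter W (H.link z)
    have e2 := card_sdiff_add_card_inter (H.link z) W
    rw [inter_comm] at e2
    exact_mod_cast (by omega : #(W \ H.link z) + #(H.link z) = #W + #(H.link z \ W))
  have h4 : #(symmDiff (H.link z) W) = #(H.link z \ W) + #(W \ H.link z) := by
    rw [symmDiff_def, sup_eq_union, card_union_of_disjoint disjoint_sdiff_sdiff]
  have h5 := h z hz
  rw [h4]
  push_cast
  nlinarith

/-- In a set of pairwise link-close vertices all vertices have the same type. -/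
theorem exists_type {β κ : ℝ} {A D : Finset V} {I J : Finset ℕ} {G A' C : Finset V}
    (hβ : β = 1 / (12 * m.factorial)) (hκ : κ < 1 / 24) (hn : 0 < #H.verts)
    (hIJ : Disjoint I J) (hA : ∀ a ∈ A, ∀ b ∈ A, H.LinkClose β a b)
    (h : ∀ a ∈ A \ D,
      (#(symmDiff (H.link a) (slice G A' C m I)) : ℝ) ≤
        κ * ((#H.verts : ℝ) ^ m / m.factorial) ∨
      (#(symmDiff (H.link a) (slice G A' C m J)) : ℝ) ≤
        κ * ((#H.verts : ℝ) ^ m / m.factorial)) :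
    ∃ K, (K = I ∨ K = J) ∧ ∀ a ∈ A \ D,
      (#(symmDiff (H.link a) (slice G A' C m K)) : ℝ) ≤
        κ * ((#H.verts : ℝ) ^ m / m.factorial) := by
  have hn' : (0 : ℝ) < #H.verts := by exact_mod_cast hn
  by_cases hall : ∀ a ∈ A \ D, (#(symmDiff (H.link a) (slice G A' C m I)) : ℝ) ≤
        κ * ((#H.verts : ℝ) ^ m / m.factorial)
  · exact ⟨I, Or.inl rfl, hall⟩
  push Not at hall
  obtain ⟨b, hb, hbI⟩ := hall
  have hbJ := (h b hb).resolve_left (not_le.2 hbI)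
  refine ⟨J, Or.inr rfl, fun a ha => (h a ha).resolve_left fun haI => ?_⟩
  have h1 := hA a (mem_sdiff.1 ha).1 b (mem_sdiff.1 hb).1
  rw [LinkClose, hβ, show 1 / (12 * (m.factorial : ℝ)) * (#H.verts : ℝ) ^ m =
    ((#H.verts : ℝ) ^ m / m.factorial) / 12 by field_simp] at h1
  have hN0 : 0 < (#H.verts : ℝ) ^ m / m.factorial := by positivity
  set N := (#H.verts : ℝ) ^ m / m.factorial
  -- The two slices are disjoint, so a common link set is an error for `a` or for `b`. That allows
  -- at most `2 κ N < N / 12` of them, too few for link-close vertices.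
  have hsub : H.link a ∩ H.link b ⊆
      symmDiff (H.link a) (slice G A' C m I) ∪ symmDiff (H.link b) (slice G A' C m J) := by
    intro T hT
    rw [mem_inter] at hT
    have hd : T ∈ slice G A' C m I → T ∉ slice G A' C m J := fun h =>
      disjoint_left.1 (disjoint_slice G A' C m hIJ) h
    rw [mem_union, mem_symmDiff, mem_symmDiff]
    tauto
  have h2 := (card_le_card hsub).trans (card_union_le _ _)
  have h3 : (#(H.link a ∩ H.link b) : ℝ) ≤ #(symmDiff (H.link a) (slice G A' C m I)) +
      #(symmDiff (H.link b) (slice G A' C m J)) := by exact_mod_cast h2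
  nlinarith

end Types

/-! ### Signed counts and dense slices -/

section Counting

/-- A signed count of the `m`-subsets of a set in terms of a power sum. -/
theorem abs_pow_sub_factorial_mul_sum_prod_le {V : Type u} [DecidableEq V] (G : Finset V)
    (s : V → ℝ) (hs : ∀ v ∈ G, |s v| ≤ 1) (m : ℕ) :
    #G * |(∑ v ∈ G, s v) ^ m - m.factorial * ∑ T ∈ G.powersetCard m, ∏ v ∈ T, s v| ≤
      m ^ 2 * (#G : ℝ) ^ m := by
  induction m with
  | zero => simp
  | succ m ih =>
    set p := ∑ v ∈ G, s v with hp
    set e := ∑ T ∈ G.powersetCard m, ∏ v ∈ T, s v with he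
    set e' := ∑ T ∈ G.powersetCard (m + 1), ∏ v ∈ T, s v with he'
    set r := ∑ T ∈ G.powersetCard m, ∑ v ∈ T, s v * ∏ w ∈ T, s w with hr
    -- Multiplying the elementary symmetric sum by `p` adds one vertex: a new vertex yields each `(m
    -- + 1)`-set `m + 1` times, a repeated one goes into the error `r`. Since `m! |r| ≤ m n ^ m`,
    -- the error constant grows from `m ^ 2` to at most `m ^ 2 + m`.
    have hrec : p * e = (m + 1) * e' + r := by
      have h1 : p * e = ∑ T ∈ G.powersetCard m, ∑ v ∈ G \ T, s v * ∏ w ∈ T, s w + r := by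
        rw [hr, ← sum_add_distrib, he, mul_sum]
        refine sum_congr rfl fun T hT => ?_
        rw [sum_sdiff (mem_powersetCard.1 hT).1, hp, sum_mul]
      have h2 : ∑ T ∈ G.powersetCard m, ∑ v ∈ G \ T, s v * ∏ w ∈ T, s w =
          ∑ U ∈ G.powersetCard (m + 1), ∑ v ∈ U, ∏ w ∈ U, s w := by
        rw [sum_sigma', sum_sigma']
        refine sum_bij' (fun q _ => ⟨insert q.2 q.1, q.2⟩) (fun q _ => ⟨q.1.erase q.2, q.2⟩)
          ?_ ?_ ?_ ?_ ?_
        · rintro ⟨T, v⟩ hq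
          simp only [mem_sigma, mem_powersetCard, mem_sdiff] at hq ⊢
          refine ⟨⟨insert_subset hq.2.1 hq.1.1, ?_⟩, mem_insert_self _ _⟩
          rw [card_insert_of_notMem hq.2.2, hq.1.2]
        · rintro ⟨U, v⟩ hq
          simp only [mem_sigma, mem_powersetCard, mem_sdiff] at hq ⊢
          refine ⟨⟨(erase_subset _ _).trans hq.1.1, ?_⟩, hq.1.1 hq.2, notMem_erase _ _⟩
          rw [card_erase_of_mem hq.2, hq.1.2, Nat.add_sub_cancel]
        · rintro ⟨T, v⟩ hq
          simp only [mem_sigma, mem_powersetCard, mem_sdiff] at hq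
          simp [erase_insert hq.2.2]
        · rintro ⟨U, v⟩ hq
          simp only [mem_sigma] at hq
          simp [insert_erase hq.2]
        · rintro ⟨T, v⟩ hq
          simp only [mem_sigma, mem_powersetCard, mem_sdiff] at hq
          simp [prod_insert hq.2.2]
      rw [h1, h2, he', mul_sum]
      congr 1
      refine sum_congr rfl fun U hU => ?_
      rw [sum_const, (mem_powersetCard.1 hU).2, nsmul_eq_mul]
      push_cast; ring
    have hprod : ∀ T ⊆ G, |∏ v ∈ T, s v| ≤ 1 := by
      intro T hT
      rw [abs_prod]
      exact prod_le_one (fun _ _ => abs_nonneg _) fun v hv => hs v (hT hv)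
    have hrb : m.factorial * |r| ≤ m * (#G : ℝ) ^ m := by
      have h1 : |r| ≤ #(G.powersetCard m) * m := by
        rw [hr]
        refine (abs_sum_le_sum_abs _ _).trans ?_
        rw [← nsmul_eq_mul]
        refine sum_le_card_nsmul _ _ _ fun T hT => ?_
        rw [mem_powersetCard] at hT
        refine (abs_sum_le_sum_abs _ _).trans ?_
        calc ∑ v ∈ T, |s v * ∏ w ∈ T, s w| ≤ ∑ v ∈ T, (1 : ℝ) := by
              refine sum_le_sum fun v hv => ?_
              rw [abs_mul]
              exact mul_le_one₀ (hs v (hT.1 hv)) (abs_nonneg _) (hprod T hT.1)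
          _ = m := by simp [hT.2]
      have h2 : (m.factorial : ℝ) * #(G.powersetCard m) ≤ (#G : ℝ) ^ m := by
        have := Nat.choose_le_pow_div (α := ℝ) m (#G)
        rw [le_div_iff₀ (by positivity)] at this
        rw [card_powersetCard]; linarith
      calc m.factorial * |r| ≤ m.factorial * (#(G.powersetCard m) * m) := by gcongr
        _ = (m.factorial * #(G.powersetCard m)) * m := by ring
        _ ≤ (#G : ℝ) ^ m * m := by gcongr
        _ = _ := by ring
    have hpb : |p| ≤ #G := by
      refine (abs_sum_le_sum_abs _ _).trans ((sum_le_sum hs).trans_eq (by simp))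
    have hid : p ^ (m + 1) - ((m + 1).factorial : ℝ) * e' =
        p * (p ^ m - m.factorial * e) + m.factorial * r := by
      rw [Nat.factorial_succ]; push_cast
      linear_combination (m.factorial : ℝ) * hrec
    have hG0 : (0 : ℝ) ≤ #G := by positivity
    calc #G * |p ^ (m + 1) - ((m + 1).factorial : ℝ) * e'|
        ≤ #G * (#G * |p ^ m - m.factorial * e| + m * (#G : ℝ) ^ m) := by
          rw [hid]
          gcongr
          refine (abs_add_le _ _).trans ?_
          rw [abs_mul, abs_mul, Nat.abs_cast]
          gcongr
      _ ≤ #G * (m ^ 2 * (#G : ℝ) ^ m + m * (#G : ℝ) ^ m) := by gcongr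
      _ = (m ^ 2 + m) * (#G : ℝ) ^ (m + 1) := by ring
      _ ≤ ((m + 1 : ℕ) : ℝ) ^ 2 * (#G : ℝ) ^ (m + 1) := by
          gcongr
          push_cast
          nlinarith [(Nat.cast_nonneg m : (0 : ℝ) ≤ m)]

/-- Halving `ρ` pays for the lower-order loss `i`. With `s!` in place of `i!`, the product of the
bounds for `i` and `s - i` no longer depends on `i`. -/
theorem pow_mul_le_factorial_mul_card_powersetCard {V : Type u} {A : Finset V} {n i s : ℕ}
    {ρ : ℝ} (hρ : 0 ≤ ρ) (hA : ρ * n ≤ #A) (hn : 2 * s ≤ ρ * n) (hi : i ≤ s) :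
    (ρ / 2) ^ i / s.factorial * (n : ℝ) ^ i ≤ #(A.powersetCard i) := by
  have h3 := Nat.pow_sub_le_descFactorial (#A) i
  rw [Nat.descFactorial_eq_factorial_mul_choose] at h3
  have hi' : (i : ℝ) ≤ s := by exact_mod_cast hi
  have hiA : i ≤ #A := by
    have : (i : ℝ) ≤ #A := by linarith [(Nat.cast_nonneg i : (0 : ℝ) ≤ i)]
    exact_mod_cast this
  have h4 : ρ / 2 * n ≤ (#A + 1 - i : ℕ) := by
    rw [Nat.cast_sub (by omega)]
    push_cast
    linarith
  have h5 : (ρ / 2 * n) ^ i ≤ s.factorial * (#A).choose i := by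
    calc (ρ / 2 * n) ^ i ≤ ((#A + 1 - i : ℕ) : ℝ) ^ i := by gcongr
      _ ≤ i.factorial * (#A).choose i := by exact_mod_cast h3
      _ ≤ _ := by gcongr
  rw [card_powersetCard, div_mul_eq_mul_div, div_le_iff₀ (by positivity), ← mul_pow]
  linarith

/-- For any two classes of linear size there are many sets that meet them in prescribed numbers
of vertices. -/
theorem exists_dense_slice {ρ : ℝ} (hρ : 0 < ρ) (s : ℕ) :
    ∃ lam : ℝ, 0 < lam ∧ ∃ n₀ : ℕ, ∀ {V : Type u} [DecidableEq V] (G A B : Finset V),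
      n₀ ≤ #G → A ⊆ G → B ⊆ G → Disjoint A B → ρ * #G ≤ #A → ρ * #G ≤ #B → ∀ i ≤ s,
        lam * (#G : ℝ) ^ s ≤ #(slice G A (A ∪ B) s {i}) := by
  obtain ⟨n₁, hn₁⟩ := exists_forall_le_mul (2 * s) hρ
  refine ⟨(ρ / 2) ^ s / s.factorial / s.factorial / 2 ^ s, by positivity, n₁,
    fun {V} _ G A B hn hAG hBG hAB hA hB i hi => ?_⟩
  classical
  have hn := hn₁ _ hn
  have d1 : Dense G ((ρ / 2) ^ i / s.factorial) i (· ⊆ A) :=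
    Dense.of_subset (pow_mul_le_factorial_mul_card_powersetCard hρ.le hA hn hi) fun S hS => by
      rw [mem_powersetCard] at hS
      exact ⟨⟨hS.1.trans hAG, hS.2⟩, hS.1⟩
  have d2 : Dense G ((ρ / 2) ^ (s - i) / s.factorial) (s - i) (· ⊆ B) :=
    Dense.of_subset (pow_mul_le_factorial_mul_card_powersetCard hρ.le hB hn (Nat.sub_le s i))
      fun S hS => by
        rw [mem_powersetCard] at hS
        exact ⟨⟨hS.1.trans hBG, hS.2⟩, hS.1⟩
  have d3 := d1.join (Q := fun _ T => T ⊆ B) (by positivity) (fun _ _ _ _ => d2)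
    (fun S T hS hT => hAB.mono hS hT)
  rw [Nat.add_sub_cancel' hi] at d3
  unfold Dense at d3
  refine le_trans (le_of_eq ?_) (d3.trans (Nat.cast_le.2 (card_le_card ?_)))
  · rw [show (ρ / 2) ^ s = (ρ / 2) ^ i * (ρ / 2) ^ (s - i) by
      rw [← pow_add, Nat.add_sub_cancel' hi]]
    ring
  · intro U hU
    rw [mem_filter, mem_powersetCard] at hU
    obtain ⟨hU, S, T, -, -, hS, -, hSA, hTB, rfl⟩ := hU
    rw [mem_slice, mem_singleton]
    refine ⟨hU, union_subset_union hSA hTB, ?_⟩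
    rw [union_inter_distrib_right, inter_eq_left.2 hSA,
      disjoint_iff_inter_eq_empty.1 (hAB.symm.mono_left hTB), union_empty, hS]

end Counting

/-! ### Alternation of the indices and balance of the classes -/

section Parity

variable {V : Type u} [DecidableEq V] {m : ℕ} {H : UniformHypergraph V (m + 1)}

theorem mem_link_erase {v : V} {e : Finset V} (hv : v ∈ e) :
    e.erase v ∈ H.link v ↔ e ∈ H.edges := by
  rw [mem_link, insert_erase hv]
  simp

/-- If the links of almost all vertices are described by slices, then so are almost all edges. -/
theorem exists_exceptional_edges {A B E : Finset V} {KA KB : Finset ℕ} {κ : ℝ}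
    (hκ : 0 ≤ κ) (hAB : Disjoint A B)
    (hE : H.verts \ (A ∪ B) ⊆ E) (hEc : (#E : ℝ) ≤ κ * #H.verts)
    (hA : ∀ a ∈ A \ E, (#(symmDiff (H.link a) (slice H.verts A (A ∪ B) m KA)) : ℝ) ≤
      κ * ((#H.verts : ℝ) ^ m / m.factorial))
    (hB : ∀ a ∈ B \ E, (#(symmDiff (H.link a) (slice H.verts A (A ∪ B) m KB)) : ℝ) ≤
      κ * ((#H.verts : ℝ) ^ m / m.factorial)) :
    ∃ X : Finset (Finset V), (#X : ℝ) ≤ 2 * κ * (#H.verts : ℝ) ^ (m + 1) ∧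
      ∀ e ∈ H.verts.powersetCard (m + 1), e ∉ X → e ⊆ A ∪ B ∧
        (∀ v ∈ e, v ∈ A → (e ∈ H.edges ↔ #(e ∩ A) - 1 ∈ KA)) ∧
        (∀ v ∈ e, v ∈ B → (e ∈ H.edges ↔ #(e ∩ A) ∈ KB)) := by
  classical
  set D : V → Finset (Finset V) := fun v =>
    if v ∈ A then symmDiff (H.link v) (slice H.verts A (A ∪ B) m KA)
    else symmDiff (H.link v) (slice H.verts A (A ∪ B) m KB) with hD
  have hDc : ∀ v ∈ H.verts \ E, (#(D v) : ℝ) ≤ κ * (#H.verts : ℝ) ^ m := by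
    intro v hv
    rw [mem_sdiff] at hv
    have hvAB : v ∈ A ∪ B := by
      by_contra h
      exact hv.2 (hE (mem_sdiff.2 ⟨hv.1, h⟩))
    have hN : κ * ((#H.verts : ℝ) ^ m / m.factorial) ≤ κ * (#H.verts : ℝ) ^ m := by
      gcongr
      refine div_le_self (by positivity) ?_
      exact_mod_cast Nat.one_le_iff_ne_zero.2 (Nat.factorial_ne_zero m)
    refine le_trans ?_ hN
    rw [hD]
    dsimp only
    split_ifs with hvA
    · exact hA v (mem_sdiff.2 ⟨hvA, hv.2⟩)
    · exact hB v (mem_sdiff.2 ⟨(mem_union.1 hvAB).resolve_left hvA, hv.2⟩)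
  -- Exceptional are the sets that meet `E` and those for which some vertex `v` outside `E` has
  -- `e.erase v` among the errors `D v`. For any other `e`, each of its vertices predicts correctly
  -- whether `e` is an edge; removing a vertex of `A` lowers the index by one.
  refine ⟨{e ∈ H.verts.powersetCard (m + 1) | ¬ Disjoint e E} ∪
    (H.verts \ E).biUnion fun v => (D v).image (insert v), ?_, ?_⟩
  · have h1 := card_filter_not_disjoint_le_mul (m := m + 1) (by omega) hEc
    have h2 : (#((H.verts \ E).biUnion fun v => (D v).image (insert v)) : ℝ) ≤
        #H.verts * (κ * (#H.verts : ℝ) ^ m) := by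
      calc (#((H.verts \ E).biUnion fun v => (D v).image (insert v)) : ℝ)
          ≤ ∑ v ∈ H.verts \ E, (#((D v).image (insert v)) : ℝ) := by
            exact_mod_cast card_biUnion_le
        _ ≤ ∑ v ∈ H.verts \ E, κ * (#H.verts : ℝ) ^ m :=
            sum_le_sum fun v hv => (Nat.cast_le.2 card_image_le).trans (hDc v hv)
        _ = #(H.verts \ E) * (κ * (#H.verts : ℝ) ^ m) := by rw [sum_const, nsmul_eq_mul]
        _ ≤ _ := by
            gcongr
            exact sdiff_subset
    refine (Nat.cast_le.2 (card_union_le _ _)).trans ?_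
    push_cast
    calc _ ≤ κ * (#H.verts : ℝ) ^ (m + 1) + #H.verts * (κ * (#H.verts : ℝ) ^ m) :=
          add_le_add h1 h2
      _ = _ := by ring
  · intro e he heX
    rw [mem_union, mem_filter, not_or, not_and, not_not, mem_biUnion] at heX
    push Not at heX
    have heE := heX.1 he
    rw [mem_powersetCard] at he
    have heAB : e ⊆ A ∪ B := by
      intro v hv
      by_contra h
      exact disjoint_left.1 heE hv (hE (mem_sdiff.2 ⟨he.1 hv, h⟩))
    have hgood : ∀ v ∈ e, e.erase v ∉ D v := by
      intro v hv hvD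
      exact heX.2 v (mem_sdiff.2 ⟨he.1 hv, disjoint_left.1 heE hv⟩)
        (mem_image.2 ⟨_, hvD, insert_erase hv⟩)
    have hslice : ∀ v ∈ e, ∀ K, e.erase v ∈ slice H.verts A (A ∪ B) m K ↔
        #(e.erase v ∩ A) ∈ K := by
      intro v hv K
      rw [mem_slice]
      have h1 : e.erase v ⊆ H.verts := (erase_subset _ _).trans he.1
      have h2 : e.erase v ⊆ A ∪ B := (erase_subset _ _).trans heAB
      have h3 : #(e.erase v) = m := by rw [card_erase_of_mem hv, he.2, Nat.add_sub_cancel]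
      simp [h1, h2, h3]
    refine ⟨heAB, fun v hv hvA => ?_, fun v hv hvB => ?_⟩
    · have h := hgood v hv
      simp only [hD, hvA, if_true, mem_symmDiff, mem_link_erase hv, hslice v hv] at h
      rw [erase_inter, card_erase_of_mem (mem_inter.2 ⟨hv, hvA⟩)] at h
      tauto
    · have hvA : v ∉ A := disjoint_right.1 hAB hvB
      have h := hgood v hv
      simp only [hD, hvA, if_false, mem_symmDiff, mem_link_erase hv, hslice v hv] at h
      rw [erase_inter, erase_eq_of_notMem (fun h => hvA (mem_inter.1 h).2)] at h
      tauto

/-- Each class has linear size if two disjoint slices are both large. -/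
theorem le_card_class {A B : Finset V} {I J : Finset ℕ} {κ : ℝ} (hm : 1 ≤ m) (hκ : κ ≤ 1 / 4)
    (hn : 0 < #H.verts) (hIJ : Disjoint I J)
    (hI : (1 / 2 - κ) * ((#H.verts : ℝ) ^ m / m.factorial) ≤
      #(slice H.verts A (A ∪ B) m I))
    (hJ : (1 / 2 - κ) * ((#H.verts : ℝ) ^ m / m.factorial) ≤
      #(slice H.verts A (A ∪ B) m J)) :
    (1 / (8 * m.factorial) * #H.verts : ℝ) ≤ #A ∧
      (1 / (8 * m.factorial) * #H.verts : ℝ) ≤ #B := by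
  classical
  have hn' : (0 : ℝ) < #H.verts := by exact_mod_cast hn
  have hN0 : 0 < (#H.verts : ℝ) ^ m / m.factorial := by positivity
  have key : ∀ D : Finset V, ∀ K : Finset ℕ,
      (1 / 2 - κ) * ((#H.verts : ℝ) ^ m / m.factorial) ≤ #(slice H.verts A (A ∪ B) m K) →
      (∀ T ∈ slice H.verts A (A ∪ B) m K, ¬ Disjoint T D) →
      (1 / (8 * m.factorial) * #H.verts : ℝ) ≤ #D := by
    intro D K hK hD
    by_contra! hlt
    have h1 := card_filter_not_disjoint_le_mul (m := m) hm hlt.le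
    have h2 : (#(slice H.verts A (A ∪ B) m K) : ℝ) ≤
        #{S ∈ H.verts.powersetCard m | ¬ Disjoint S D} :=
      Nat.cast_le.2 (card_le_card fun T hT => mem_filter.2 ⟨slice_subset _ _ _ _ _ hT, hD T hT⟩)
    rw [show 1 / (8 * (m.factorial : ℝ)) * (#H.verts : ℝ) ^ m =
      ((#H.verts : ℝ) ^ m / m.factorial) / 8 by field_simp] at h1
    nlinarith
  -- One of the disjoint sets `I`, `J` omits 0, and every set in its slice meets `A`; likewise one
  -- omits `m`, and every set in its slice meets `B`. By `key`, a class meeting every set of a large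
  -- slice has linear size.
  have hA0 : ∀ K : Finset ℕ, 0 ∉ K → ∀ T ∈ slice H.verts A (A ∪ B) m K, ¬ Disjoint T A := by
    intro K hK T hT hTA
    have := (mem_slice.1 hT).2.2
    rw [disjoint_iff_inter_eq_empty.1 hTA, card_empty] at this
    exact hK this
  have hBm : ∀ K : Finset ℕ, m ∉ K → ∀ T ∈ slice H.verts A (A ∪ B) m K, ¬ Disjoint T B := by
    intro K hK T hT hTB
    have hT := mem_slice.1 hT
    have : T ⊆ A := by
      intro v hv
      exact (mem_union.1 (hT.2.1 hv)).resolve_right (disjoint_left.1 hTB hv)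
    rw [inter_eq_left.2 this, hT.1.2] at hT
    exact hK hT.2.2
  constructor
  · by_cases h : 0 ∈ I
    · exact key A J hJ (hA0 J (disjoint_left.1 hIJ h))
    · exact key A I hI (hA0 I h)
  · by_cases h : m ∈ I
    · exact key B J hJ (hBm J (disjoint_left.1 hIJ h))
    · exact key B I hI (hBm I h)

theorem exists_mem_of_card_slice_pos {G A C : Finset V} {K : Finset ℕ}
    (h : 0 < #(slice G A C m K)) : ∃ i ∈ K, i ≤ m := by
  obtain ⟨T, hT⟩ := card_pos.1 h
  rw [mem_slice] at hT
  exact ⟨_, hT.2.2, (card_le_card inter_subset_left).trans hT.1.2.le⟩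

/-- The indices alternate. -/
theorem mem_iff_even_iff {I J : Finset ℕ} (hIJ : Disjoint I J)
    (hcov : ∀ i ≤ m, i ∈ I ∨ i ∈ J) (hstep : ∀ i, i + 1 ≤ m → (i ∈ J ↔ i + 1 ∈ I)) :
    ∀ i ≤ m, (i ∈ I ↔ (Even i ↔ 0 ∈ I)) := by
  intro i
  induction i with
  | zero => simp
  | succ i ih =>
    intro hi
    have h1 := ih (by omega)
    have h2 := hstep i hi
    have h3 := hcov i (by omega)
    have h4 : i ∈ I → i ∉ J := fun h => disjoint_left.1 hIJ h
    rw [Nat.even_add_one]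
    tauto

/-- If the index sets of two complementary slices alternate and the slices have almost the same
size, then the two classes have almost the same size. -/
theorem abs_card_sub_card_le {A B : Finset V} {I J : Finset ℕ} {κ ω : ℝ} (hm : 1 ≤ m)
    (hA : A ⊆ H.verts) (hB : B ⊆ H.verts) (hAB : Disjoint A B) (hA0 : 0 < #A)
    (hIJ : Disjoint I J) (hpar : ∀ i ≤ m, (i ∈ I ↔ (Even i ↔ 0 ∈ I)))
    (hcov : ∀ i ≤ m, i ∈ I ∨ i ∈ J)
    (hI : (1 / 2 - κ) * ((#H.verts : ℝ) ^ m / m.factorial) ≤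
      #(slice H.verts A (A ∪ B) m I))
    (hJ : (1 / 2 - κ) * ((#H.verts : ℝ) ^ m / m.factorial) ≤
      #(slice H.verts A (A ∪ B) m J))
    (hn : (m * m : ℕ) ≤ κ * #H.verts) (hω : 0 ≤ ω) (hκω : 3 * κ ≤ ω ^ m) :
    |(#A : ℝ) - #B| ≤ ω * #H.verts := by
  classical
  set n := #H.verts with hndef
  set G := A ∪ B with hG
  have hGV : G ⊆ H.verts := union_subset hA hB
  have hGn : (#G : ℝ) ≤ n := Nat.cast_le.2 (card_le_card hGV)
  have hG0 : (0 : ℝ) < #G := by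
    exact_mod_cast hA0.trans_le (card_le_card subset_union_left)
  set s : V → ℝ := fun v => if v ∈ A then -1 else 1 with hs
  have hsum : ∑ v ∈ G, s v = #B - #A := by
    rw [hG, sum_union hAB, sum_congr rfl (g := fun _ => (-1 : ℝ)),
      sum_congr (s₁ := B) rfl (g := fun _ => (1 : ℝ))]
    · simp; ring
    · intro v hv; exact if_neg (disjoint_right.1 hAB hv)
    · intro v hv; exact if_pos hv
  set σ : ℝ := if 0 ∈ I then 1 else -1 with hσ
  have hslice : ∀ K, (#(slice H.verts A G m K) : ℝ) =
      ∑ T ∈ G.powersetCard m, if #(T ∩ A) ∈ K then (1 : ℝ) else 0 := by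
    intro K
    rw [sum_boole]
    congr 2
    ext T
    rw [mem_slice, mem_filter, mem_powersetCard]
    exact ⟨fun h => ⟨⟨h.2.1, h.1.2⟩, h.2.2⟩, fun h => ⟨⟨h.1.1.trans hGV, h.1.2⟩, h.1.1, h.2⟩⟩
  -- The sign of `T` is `(-1) ^ #(T ∩ A)`. As the indices alternate, it separates the two slices up
  -- to the global sign `σ`, so the signed count is their difference, at most `2 κ N`.
  have hprod : ∑ T ∈ G.powersetCard m, ∏ v ∈ T, s v =
      σ * (#(slice H.verts A G m I) - #(slice H.verts A G m J)) := by
    rw [hslice, hslice, ← sum_sub_distrib, mul_sum]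
    refine sum_congr rfl fun T hT => ?_
    have hTm : #(T ∩ A) ≤ m :=
      (card_le_card inter_subset_left).trans (mem_powersetCard.1 hT).2.le
    have h1 : ∏ v ∈ T, s v = (-1) ^ #(T ∩ A) := by
      rw [hs, prod_ite, prod_const, prod_const_one, mul_one, filter_mem_eq_inter]
    rw [h1]
    have h2 := hpar _ hTm
    have h3 := hcov _ hTm
    have h4 : #(T ∩ A) ∈ I → #(T ∩ A) ∉ J := fun h => disjoint_left.1 hIJ h
    by_cases hI' : #(T ∩ A) ∈ I
    · simp only [hI', h4 hI', if_true, if_false, sub_zero, mul_one]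
      by_cases h0 : 0 ∈ I
      · rw [hσ, if_pos h0, (h2.1 hI').2 h0 |>.neg_one_pow]
      · rw [hσ, if_neg h0]
        refine Odd.neg_one_pow ?_
        rw [← Nat.not_even_iff_odd]
        exact fun h => h0 ((h2.1 hI').1 h)
    · have hJ' := h3.resolve_left hI'
      simp only [hI', hJ', if_true, if_false, zero_sub, mul_neg, mul_one]
      by_cases h0 : 0 ∈ I
      · rw [hσ, if_pos h0]
        refine Odd.neg_one_pow ?_
        rw [← Nat.not_even_iff_odd]
        exact fun h => hI' (h2.2 (by tauto))
      · rw [hσ, if_neg h0, neg_neg]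
        refine Even.neg_one_pow ?_
        by_contra h
        exact hI' (h2.2 (by tauto))
  have hσ1 : |σ| = 1 := by rw [hσ]; split_ifs <;> simp
  have hsumle : (#(slice H.verts A G m I) : ℝ) + #(slice H.verts A G m J) ≤
      (n : ℝ) ^ m / m.factorial := by
    refine le_trans ?_ (card_powersetCard_le_div H.verts m)
    rw [← Nat.cast_add, ← card_union_of_disjoint (disjoint_slice _ _ _ _ hIJ)]
    exact Nat.cast_le.2 (card_le_card (union_subset (slice_subset _ _ _ _ _)
      (slice_subset _ _ _ _ _)))
  have hpow := pow_eq_factorial_mul n m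
  have hmain := abs_pow_sub_factorial_mul_sum_prod_le G s
    (fun v _ => by simp only [hs]; split_ifs <;> simp) m
  rw [hsum, hprod] at hmain
  have hf : (0 : ℝ) < m.factorial := by positivity
  set N := (n : ℝ) ^ m / m.factorial
  clear_value N
  have hdiff : |(#(slice H.verts A G m I) : ℝ) - #(slice H.verts A G m J)| ≤ 2 * κ * N := by
    rw [abs_le]; constructor <;> linarith
  have hκn : (m : ℝ) ^ 2 * (#G : ℝ) ^ m ≤ #G * (κ * n ^ m) := by
    have h1 : (#G : ℝ) ^ m = #G * (#G : ℝ) ^ (m - 1) := by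
      rw [← pow_succ', Nat.sub_add_cancel hm]
    have h2 : (n : ℝ) ^ m = n * (n : ℝ) ^ (m - 1) := by
      rw [← pow_succ', Nat.sub_add_cancel hm]
    rw [h1, h2]
    push_cast at hn
    have hκn0 : 0 ≤ κ * (n : ℝ) := le_trans (mul_self_nonneg _) hn
    calc (m : ℝ) ^ 2 * (#G * (#G : ℝ) ^ (m - 1)) = #G * ((m * m) * (#G : ℝ) ^ (m - 1)) := by ring
      _ ≤ #G * ((κ * n) * (n : ℝ) ^ (m - 1)) := by gcongr
      _ = _ := by ring
  have h1 := le_of_mul_le_mul_left (hmain.trans hκn) hG0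
  -- The approximation of the power by the signed count costs `κ n ^ m` and the signed count itself
  -- `2 κ n ^ m`; together this is the `3 κ` allowed by `hκω`.
  have h2 : |((#B : ℝ) - #A) ^ m| ≤ κ * n ^ m + m.factorial * (2 * κ * N) := by
    have e : ((#B : ℝ) - #A) ^ m = (((#B : ℝ) - #A) ^ m - m.factorial *
        (σ * (#(slice H.verts A G m I) - #(slice H.verts A G m J)))) + m.factorial *
        (σ * (#(slice H.verts A G m I) - #(slice H.verts A G m J))) := by ring
    rw [e]
    refine (abs_add_le _ _).trans (add_le_add h1 ?_)
    rw [abs_mul, abs_mul, hσ1, one_mul, Nat.abs_cast]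
    gcongr
  rw [show (m.factorial : ℝ) * (2 * κ * N) = 2 * κ * (m.factorial * N) by ring, ← hpow,
    abs_pow, abs_sub_comm] at h2
  refine le_of_pow_le_pow_left₀ (by omega : m ≠ 0)
    (mul_nonneg hω (Nat.cast_nonneg _)) (h2.trans ?_)
  rw [mul_pow]
  have : (0 : ℝ) ≤ (n : ℝ) ^ m := pow_nonneg (Nat.cast_nonneg _) _
  nlinarith

end Parity

/-- Stability: if the links of almost all vertices are described by two complementary families of
slices, one for each class, then `H` is almost determined by a parity condition with respect to a
balanced partition. -/
theorem exists_parity {m : ℕ} (hm : 1 ≤ m) {ω β : ℝ} (hω : 0 < ω)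
    (hβ : β = 1 / (12 * m.factorial)) :
    ∃ κ : ℝ, 0 < κ ∧ ∃ n₀ : ℕ, ∀ {V : Type u} [DecidableEq V] (H : UniformHypergraph V (m + 1)),
      n₀ ≤ #H.verts → ∀ (A B E : Finset V) (I J : Finset ℕ), A ⊆ H.verts → B ⊆ H.verts →
      Disjoint A B → H.verts \ (A ∪ B) ⊆ E → (#E : ℝ) ≤ κ * #H.verts →
      (∀ a ∈ A, ∀ b ∈ A, H.LinkClose β a b) → (∀ a ∈ B, ∀ b ∈ B, H.LinkClose β a b) →
      Disjoint I J →
      (1 / 2 - κ) * ((#H.verts : ℝ) ^ m / m.factorial) ≤ #(slice H.verts A (A ∪ B) m I) →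
      (1 / 2 - κ) * ((#H.verts : ℝ) ^ m / m.factorial) ≤ #(slice H.verts A (A ∪ B) m J) →
      (∀ z ∈ H.verts \ E,
        (#(symmDiff (H.link z) (slice H.verts A (A ∪ B) m I)) : ℝ) ≤
          κ * ((#H.verts : ℝ) ^ m / m.factorial) ∨
        (#(symmDiff (H.link z) (slice H.verts A (A ∪ B) m J)) : ℝ) ≤
          κ * ((#H.verts : ℝ) ^ m / m.factorial)) →
      ∃ b : Prop, |(#A : ℝ) - #B| ≤ ω * #H.verts ∧
        ∃ X : Finset (Finset V), (#X : ℝ) ≤ ω * (#H.verts : ℝ) ^ (m + 1) ∧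
          ∀ e ∈ H.verts.powersetCard (m + 1), e ∉ X →
            (e ∈ H.edges ↔ (Even #(e ∩ A) ↔ b)) := by
  have hρ : (0 : ℝ) < 1 / (8 * m.factorial) := by positivity
  obtain ⟨l₁, hl₁, n₁, h₁⟩ := exists_dense_slice.{u} hρ (m + 1)
  obtain ⟨l₂, hl₂, n₂, h₂⟩ := exists_dense_slice.{u} hρ m
  -- The bound `1 / 48` is for `exists_type`; `l₁ / 4` leaves a non-exceptional set in each dense
  -- slice of `(m + 1)`-sets; `l₂ / 4` excludes a third dense slice of `m`-sets; `ω / 2` bounds the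
  -- exceptional sets and `ω ^ m / 3` the imbalance.
  set κ := min (min (1 / 48) (min (l₁ / 4) (l₂ / 4))) (min (ω / 2) (ω ^ m / 3)) with hκdef
  have hκ0 : 0 < κ := by positivity
  have hκ1 : κ ≤ 1 / 48 := (min_le_left _ _).trans (min_le_left _ _)
  have hκ2 : κ ≤ l₁ / 4 := (min_le_left _ _).trans ((min_le_right _ _).trans (min_le_left _ _))
  have hκ3 : κ ≤ l₂ / 4 := (min_le_left _ _).trans ((min_le_right _ _).trans (min_le_right _ _))
  have hκ4 : κ ≤ ω / 2 := (min_le_right _ _).trans (min_le_left _ _)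
  have hκ5 : κ ≤ ω ^ m / 3 := (min_le_right _ _).trans (min_le_right _ _)
  obtain ⟨n₃, hn₃⟩ := exists_forall_le_mul (m * m : ℕ) hκ0
  refine ⟨κ, hκ0, max (max n₁ n₂) (max n₃ 1), ?_⟩
  intro V _ H hn A B E I J hA hB hAB hE hEc hcA hcB hIJ hI hJ htype
  simp only [max_le_iff] at hn
  obtain ⟨⟨hn1, hn2⟩, hn3, hn4⟩ := hn
  have hn4' : (0 : ℝ) < #H.verts := by exact_mod_cast hn4
  obtain ⟨hAρ, hBρ⟩ := le_card_class (H := H) hm (by linarith) hn4 hIJ hI hJ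
  have hA0 : 0 < #A := by
    have : (0 : ℝ) < #A := lt_of_lt_of_le (by positivity) hAρ
    exact_mod_cast this
  have hV : ∀ {A}, A ⊆ H.verts → ∀ z ∈ A \ E, z ∈ H.verts \ E := fun hA z hz =>
    sdiff_subset_sdiff hA le_rfl hz
  have hpos : ∀ K, (1 / 2 - κ) * ((#H.verts : ℝ) ^ m / m.factorial) ≤
      #(slice H.verts A (A ∪ B) m K) → ∃ i ∈ K, i ≤ m := by
    intro K hK
    refine exists_mem_of_card_slice_pos (G := H.verts) (A := A) (C := A ∪ B) ?_
    have : (0 : ℝ) < #(slice H.verts A (A ∪ B) m K) := by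
      refine lt_of_lt_of_le (mul_pos (by linarith) (by positivity)) hK
    exact_mod_cast this
  -- A missing index would give a dense slice disjoint from two slices that already contain almost
  -- all `m`-sets.
  have hcov : ∀ i ≤ m, i ∈ I ∨ i ∈ J := by
    intro i hi
    by_contra! hcon
    have e1 := h₂ H.verts A B hn2 hA hB hAB hAρ hBρ i hi
    have d1 : Disjoint ({i} : Finset ℕ) (I ∪ J) := by simp [hcon.1, hcon.2]
    have e2 : #(slice H.verts A (A ∪ B) m {i}) + (#(slice H.verts A (A ∪ B) m I) +
        #(slice H.verts A (A ∪ B) m J)) ≤ #(H.verts.powersetCard m) := by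
      rw [← card_union_of_disjoint (disjoint_slice _ _ _ _ hIJ), ← card_union_of_disjoint]
      · exact card_le_card (union_subset (slice_subset _ _ _ _ _)
          (union_subset (slice_subset _ _ _ _ _) (slice_subset _ _ _ _ _)))
      · rw [disjoint_union_right]
        rw [disjoint_union_right] at d1
        exact ⟨disjoint_slice _ _ _ _ d1.1, disjoint_slice _ _ _ _ d1.2⟩
    have e3 : (#(slice H.verts A (A ∪ B) m {i}) : ℝ) + (#(slice H.verts A (A ∪ B) m I) +
        #(slice H.verts A (A ∪ B) m J)) ≤ #(H.verts.powersetCard m) := by exact_mod_cast e2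
    have e4 := card_powersetCard_le_div H.verts m
    have e5 : (#H.verts : ℝ) ^ m / m.factorial ≤ (#H.verts : ℝ) ^ m := by
      refine div_le_self (by positivity) ?_
      exact_mod_cast Nat.one_le_iff_ne_zero.2 (Nat.factorial_ne_zero m)
    have e6 : (0 : ℝ) < (#H.verts : ℝ) ^ m := by positivity
    nlinarith
  have main : ∀ KA KB : Finset ℕ,
      (∀ a ∈ A \ E, (#(symmDiff (H.link a) (slice H.verts A (A ∪ B) m KA)) : ℝ) ≤
        κ * ((#H.verts : ℝ) ^ m / m.factorial)) →
      (∀ a ∈ B \ E, (#(symmDiff (H.link a) (slice H.verts A (A ∪ B) m KB)) : ℝ) ≤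
        κ * ((#H.verts : ℝ) ^ m / m.factorial)) →
      (∀ i, i + 1 ≤ m → (i ∈ KA ↔ i + 1 ∈ KB)) ∧
      ((∀ i ≤ m, (i ∈ KA ↔ i ∉ KB)) → (∀ i ≤ m, (i ∈ KB ↔ (Even i ↔ 0 ∈ KB))) →
        ∃ X : Finset (Finset V), (#X : ℝ) ≤ ω * (#H.verts : ℝ) ^ (m + 1) ∧
          ∀ e ∈ H.verts.powersetCard (m + 1), e ∉ X →
            (e ∈ H.edges ↔ (Even #(e ∩ A) ↔ 0 ∈ KB))) := by
    intro KA KB hKA hKB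
    obtain ⟨X, hXc, hX⟩ := exists_exceptional_edges hκ0.le hAB hE hEc hKA hKB
    constructor
    · intro i hi
      have e1 := h₁ H.verts A B hn1 hA hB hAB hAρ hBρ (i + 1) (by omega)
      -- A non-exceptional set with `i + 1` vertices in `A`, and at least one in `B` because `i + 1
      -- ≤ m`. A vertex in `A` says that it is an edge iff `i ∈ KA`, one in `B` iff `i + 1 ∈ KB`.
      obtain ⟨e, he, heX⟩ : ∃ e ∈ slice H.verts A (A ∪ B) (m + 1) {i + 1}, e ∉ X := by
        by_contra! hcon
        have e2 : (#(slice H.verts A (A ∪ B) (m + 1) {i + 1}) : ℝ) ≤ #X :=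
          Nat.cast_le.2 (card_le_card hcon)
        have e3 : (0 : ℝ) < (#H.verts : ℝ) ^ (m + 1) := by positivity
        nlinarith
      rw [mem_slice, mem_singleton] at he
      obtain ⟨h1, h2, h3⟩ := hX e (mem_powersetCard.2 he.1) heX
      obtain ⟨v, hv⟩ : (e ∩ A).Nonempty := card_pos.1 (by omega)
      obtain ⟨w, hw⟩ : (e \ A).Nonempty := card_pos.1 (by
        have := card_sdiff_add_card_inter e A
        omega)
      rw [mem_inter] at hv
      rw [mem_sdiff] at hw
      have h4 := h2 v hv.1 hv.2
      have h5 := h3 w hw.1 ((mem_union.1 (h1 hw.1)).resolve_left hw.2)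
      rw [he.2.2] at h4 h5
      exact h4.symm.trans h5
    · intro hcompl hpar
      refine ⟨X, hXc.trans (by gcongr; linarith), fun e he heX => ?_⟩
      obtain ⟨h1, h2, h3⟩ := hX e he heX
      have hecard := (mem_powersetCard.1 he).2
      have := card_sdiff_add_card_inter e A
      by_cases heA : (e \ A).Nonempty
      · have := card_pos.2 heA
        obtain ⟨w, hw⟩ := heA
        rw [mem_sdiff] at hw
        rw [h3 w hw.1 ((mem_union.1 (h1 hw.1)).resolve_left hw.2)]
        exact hpar _ (by omega)
      -- A set inside `A` has no vertex in `B` to consult, so `KA` at the index `m` decides, and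
      -- complementarity turns this into the parity of `m + 1`.
      · rw [not_nonempty_iff_eq_empty] at heA
        rw [heA, card_empty] at this
        obtain ⟨v, hv⟩ : (e ∩ A).Nonempty := card_pos.1 (by omega)
        rw [mem_inter] at hv
        rw [h2 v hv.1 hv.2, show #(e ∩ A) = m + 1 by omega, Nat.add_sub_cancel,
          hcompl m le_rfl, hpar m le_rfl, Nat.even_add_one]
        tauto
  -- Excludes that both classes have the same type: membership in that index set would be constant
  -- on `0, …, m`, although both `I` and `J` have elements there.
  have noconst : ∀ I J : Finset ℕ, Disjoint I J → (∃ i ∈ I, i ≤ m) → (∃ i ∈ J, i ≤ m) →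
      ¬ (∀ i, i + 1 ≤ m → (i ∈ I ↔ i + 1 ∈ I)) := by
    rintro I J hIJ ⟨i, hi, him⟩ ⟨j, hj, hjm⟩ hstep
    have hall : ∀ i ≤ m, (i ∈ I ↔ 0 ∈ I) := by
      intro i
      induction i with
      | zero => simp
      | succ i ih => exact fun h => (hstep i h).symm.trans (ih (by omega))
    exact disjoint_right.1 hIJ hj ((hall j hjm).2 ((hall i him).1 hi))
  have hcompl : ∀ I J : Finset ℕ, Disjoint I J → (∀ i ≤ m, i ∈ I ∨ i ∈ J) →
      ∀ i ≤ m, (i ∈ I ↔ i ∉ J) := fun I J hIJ hcov i hi =>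
    ⟨fun h => disjoint_left.1 hIJ h, fun h => (hcov i hi).resolve_right h⟩
  obtain ⟨KA, hKA, hKA'⟩ := exists_type (D := E) hβ (by linarith) hn4 hIJ hcA
    fun a ha => htype a (hV hA a ha)
  obtain ⟨KB, hKB, hKB'⟩ := exists_type (D := E) hβ (by linarith) hn4 hIJ hcB
    fun a ha => htype a (hV hB a ha)
  obtain ⟨hstep, hcount⟩ := main KA KB hKA' hKB'
  have fin : ∀ KA KB : Finset ℕ, Disjoint KB KA → (∀ i ≤ m, i ∈ KB ∨ i ∈ KA) →
      (∀ i, i + 1 ≤ m → (i ∈ KA ↔ i + 1 ∈ KB)) →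
      (1 / 2 - κ) * ((#H.verts : ℝ) ^ m / m.factorial) ≤ #(slice H.verts A (A ∪ B) m KB) →
      (1 / 2 - κ) * ((#H.verts : ℝ) ^ m / m.factorial) ≤ #(slice H.verts A (A ∪ B) m KA) →
      (∀ i ≤ m, (i ∈ KA ↔ i ∉ KB)) ∧ (∀ i ≤ m, (i ∈ KB ↔ (Even i ↔ 0 ∈ KB))) ∧
        |(#A : ℝ) - #B| ≤ ω * #H.verts := by
    intro KA KB hd hc hs hKB hKA
    have hp := mem_iff_even_iff hd hc hs
    exact ⟨hcompl KA KB hd.symm fun i hi => (hc i hi).symm, hp,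
      abs_card_sub_card_le hm hA hB hAB hA0 hd hp hc hKB hKA (hn₃ _ hn3) hω.le (by linarith)⟩
  rcases hKA with rfl | rfl <;> rcases hKB with rfl | rfl
  · exact absurd hstep (noconst _ _ hIJ (hpos _ hI) (hpos _ hJ))
  · obtain ⟨f1, f2, f3⟩ := fin _ _ hIJ.symm (fun i hi => (hcov i hi).symm) hstep hJ hI
    exact ⟨_, f3, hcount f1 f2⟩
  · obtain ⟨f1, f2, f3⟩ := fin _ _ hIJ hcov hstep hI hJ
    exact ⟨_, f3, hcount f1 f2⟩
  · exact absurd hstep (noconst _ _ hIJ.symm (hpos _ hJ) (hpos _ hI))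

/-! ### Closeness to the balanced parity hypergraph -/

/-- A set can be changed into a set of prescribed size by moving as few elements as necessary. -/
theorem exists_card_eq_card_symmDiff_le {V : Type u} [DecidableEq V] {A G : Finset V} (hA : A ⊆ G)
    {r : ℕ} (hr : r ≤ #G) :
    ∃ D ⊆ G, #D = r ∧ (#(symmDiff A D) : ℝ) ≤ |(#A : ℝ) - r| := by
  rcases le_total r #A with h | h
  · obtain ⟨D, hDA, hD⟩ := exists_subset_card_eq h
    refine ⟨D, hDA.trans hA, hD, ?_⟩
    rw [symmDiff_of_ge hDA, card_sdiff_of_subset hDA, hD, Nat.cast_sub h]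
    exact le_abs_self _
  · obtain ⟨D, hAD, hDG, hD⟩ := exists_subsuperset_card_eq hA h hr
    refine ⟨D, hDG, hD, ?_⟩
    rw [symmDiff_of_le hAD, card_sdiff_of_subset hAD, hD, Nat.cast_sub h, abs_sub_comm]
    exact le_abs_self _

theorem image_inter_of_bijOn {V : Type u} [DecidableEq V] {f : V → ℕ} {A D e : Finset V}
    {R : Finset ℕ} (hf : Set.InjOn f D) (hA : A ⊆ D) (he : e ⊆ D) (hR : A.image f = R) :
    #(e.image f ∩ R) = #(e ∩ A) := by
  rw [← hR, ← image_inter_of_injOn]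
  · exact card_image_of_injOn (hf.mono (by exact_mod_cast inter_subset_left.trans he))
  · exact hf.mono (by exact_mod_cast union_subset he hA)

/-- A hypergraph whose edges are almost determined by a parity condition with respect to an
almost balanced partition is close to the balanced parity hypergraph or its complement. -/
theorem isClose_of_parity {V : Type u} [DecidableEq V] {m : ℕ} (H : UniformHypergraph V (m + 1))
    {A : Finset V} (hA : A ⊆ H.verts) {ω : ℝ} {b : Prop} {X : Finset (Finset V)}
    (hbal : |2 * (#A : ℝ) - #H.verts| ≤ 2 * ω * #H.verts) (hn : 1 ≤ ω * #H.verts)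
    (hXc : (#X : ℝ) ≤ ω * (#H.verts : ℝ) ^ (m + 1))
    (hX : ∀ e ∈ H.verts.powersetCard (m + 1), e ∉ X → (e ∈ H.edges ↔ (Even #(e ∩ A) ↔ b))) :
    H.IsClose (3 * ω) (balancedOdd #H.verts (m + 1)) ∨
      H.IsClose (3 * ω) (balancedOdd #H.verts (m + 1)).compl := by
  classical
  set n := #H.verts with hndef
  obtain ⟨D, hDV, hDc, hAD⟩ := exists_card_eq_card_symmDiff_le hA (r := n / 2) (Nat.div_le_self _ _)
  have hdist : (#(symmDiff A D) : ℝ) ≤ ω * n + 1 := by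
    refine hAD.trans ?_
    have h1 : (2 * (n / 2 : ℕ) : ℝ) ≤ n := by exact_mod_cast Nat.mul_div_le n 2
    have h2 : (n : ℝ) ≤ 2 * (n / 2 : ℕ) + 1 := by
      exact_mod_cast (by omega : n ≤ 2 * (n / 2) + 1)
    rw [abs_le] at hbal ⊢
    constructor <;> linarith
  set R := range (n / 2) with hR
  set R' := Ico (n / 2) n with hR'
  have hRR' : R ∪ R' = range n := by
    ext i; simp only [hR, hR', mem_union, mem_range, mem_Ico]; omega
  have hdisj : Disjoint R R' := by
    rw [disjoint_left]; intro i; simp only [hR, hR', mem_range, mem_Ico]; omega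
  obtain ⟨f, hf1, hf2, hf⟩ := exists_bijOn_union (S₁ := D) (S₂ := H.verts \ D) (T₁ := R)
    (T₂ := R') (by simp [hR, hDc]) (by simp [hR', card_sdiff_of_subset hDV, hDc, ← hndef])
    disjoint_sdiff hdisj
  rw [← coe_union, ← coe_union, union_sdiff_of_subset hDV, hRR'] at hf
  have hDR : D.image f = R := by
    rw [← coe_inj, coe_image]; exact hf1.image_eq
  have himg : ∀ e ∈ H.verts.powersetCard (m + 1), e.image f ∈ (range n).powersetCard (m + 1) := by
    intro e he
    rw [mem_powersetCard] at he ⊢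
    constructor
    · intro i hi
      obtain ⟨v, hv, rfl⟩ := mem_image.1 hi
      exact hf.mapsTo (he.1 hv)
    · rw [card_image_of_injOn (hf.injOn.mono (by exact_mod_cast he.1)), he.2]
  have hsurj : ∀ e' ∈ (range n).powersetCard (m + 1),
      ∃ e ∈ H.verts.powersetCard (m + 1), e.image f = e' := by
    intro e' he'
    rw [mem_powersetCard] at he'
    have h1 : ({v ∈ H.verts | f v ∈ e'}).image f = e' := by
      ext i
      simp only [mem_image, mem_filter]
      constructor
      · rintro ⟨v, ⟨-, h⟩, rfl⟩; exact h
      · intro hi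
        obtain ⟨v, hv, rfl⟩ := hf.surjOn (he'.1 hi)
        exact ⟨v, ⟨hv, hi⟩, rfl⟩
    refine ⟨{v ∈ H.verts | f v ∈ e'}, mem_powersetCard.2 ⟨filter_subset _ _, ?_⟩, h1⟩
    refine Eq.trans ?_ he'.2
    conv_rhs => rw [← h1]
    exact (card_image_of_injOn (hf.injOn.mono (by exact_mod_cast filter_subset _ _))).symm
  have hinj : ∀ e ∈ H.verts.powersetCard (m + 1), (e.image f ∈ H.edges.image (image f) ↔
      e ∈ H.edges) := by
    intro e he
    refine ⟨fun h => ?_, fun h => mem_image_of_mem _ h⟩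
    obtain ⟨e₁, he₁, h1⟩ := mem_image.1 h
    have h2 : (e₁ : Set V) ⊆ H.verts := by exact_mod_cast edge_subset he₁
    have h3 : (e : Set V) ⊆ H.verts := by exact_mod_cast (mem_powersetCard.1 he).1
    have : (e₁ : Set V) = e := by
      refine (hf.injOn.image_eq_image_iff h2 h3).1 ?_
      exact_mod_cast h1
    rw [← coe_inj.1 this]; exact he₁
  let H₁ : UniformHypergraph ℕ (m + 1) :=
    { verts := range n
      edges := H.edges.image (image f)
      edges_subset := fun e' he' => by
        obtain ⟨e, he, rfl⟩ := mem_image.1 he'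
        exact himg e (H.edges_subset he) }
  have hcopy : H.IsCopy H₁ := ⟨f, hf, rfl⟩
  have hverts : H₁.verts = (balancedOdd n (m + 1)).verts := hRR'.symm
  -- Replacing `A` by `D`, which has exactly `⌊n / 2⌋` elements, affects only the sets meeting the
  -- symmetric difference: at most `(ω n + 1) n ^ m ≤ 2 ω n ^ (m + 1)`. With `X` this gives `3 ω`.
  set Y : Finset (Finset V) := X ∪ {e ∈ H.verts.powersetCard (m + 1) | ¬ Disjoint e (symmDiff A D)}
    with hY
  have hYc : (#Y : ℝ) ≤ 3 * ω * (n : ℝ) ^ (m + 1) := by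
    have h1 : (#Y : ℝ) ≤ #X + #(symmDiff A D) * (n : ℝ) ^ m := by
      exact_mod_cast (card_union_le _ _).trans
        (Nat.add_le_add_left (card_filter_not_disjoint_le H.verts _ m) _)
    have h2 : (#(symmDiff A D) : ℝ) * (n : ℝ) ^ m ≤ (2 * (ω * n)) * (n : ℝ) ^ m := by
      gcongr; linarith
    calc (#Y : ℝ) ≤ ω * (n : ℝ) ^ (m + 1) + (2 * (ω * n)) * (n : ℝ) ^ m := by linarith
      _ = _ := by ring
  have hYX : ∀ e ∈ H.verts.powersetCard (m + 1), e ∉ Y →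
      (e ∈ H.edges ↔ (Even #(e ∩ D) ↔ b)) := by
    intro e he heY
    rw [hY, mem_union, mem_filter, not_or, not_and, not_not] at heY
    have h1 : e ∩ A = e ∩ D := by
      have h2 := heY.2 he
      ext v
      have h3 : v ∈ e → v ∉ symmDiff A D := fun h => disjoint_left.1 h2 h
      rw [mem_symmDiff] at h3
      simp only [mem_inter]
      tauto
    rw [← h1]
    exact hX e he heY.1
  have hbound : ∀ F : Finset (Finset ℕ), F ⊆ (range n).powersetCard (m + 1) →
      (∀ e ∈ H.verts.powersetCard (m + 1), e ∉ Y → (e ∈ H.edges ↔ e.image f ∈ F)) →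
      (#(symmDiff H₁.edges F) : ℝ) ≤ 3 * ω * (n : ℝ) ^ (m + 1) := by
    intro F hF hFe
    refine le_trans (Nat.cast_le.2 ((card_le_card ?_).trans (card_image_le (s := Y)
      (f := image f)))) hYc
    intro e' he'
    have he'r : e' ∈ (range n).powersetCard (m + 1) := by
      rw [mem_symmDiff] at he'
      rcases he' with h | h
      · exact H₁.edges_subset h.1
      · exact hF h.1
    obtain ⟨e, he, rfl⟩ := hsurj e' he'r
    refine mem_image_of_mem _ ?_
    by_contra heY
    have h1 := hFe e he heY
    have h2 := hinj e he
    rw [mem_symmDiff] at he'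
    change (e.image f ∈ H.edges.image (image f) ∧ _) ∨ (_ ∧ e.image f ∉ H.edges.image (image f))
      at he'
    tauto
  have hodd : ∀ e ∈ H.verts.powersetCard (m + 1),
      (e.image f ∈ (balancedOdd n (m + 1)).edges ↔ ¬ Even #(e ∩ D)) := by
    intro e he
    change e.image f ∈ ({e ∈ (R ∪ R').powersetCard (m + 1) | Odd #(e ∩ R)}) ↔ _
    rw [mem_filter, hRR', image_inter_of_bijOn hf.injOn hDV (mem_powersetCard.1 he).1 hDR,
      Nat.not_even_iff_odd]
    exact and_iff_right (himg e he)
  -- If `b` holds the edges are essentially the even sets, which form the complement; otherwise they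
  -- are the odd ones.
  by_cases hb : b
  · right
    refine ⟨H₁, hcopy, hverts, hbound _ ?_ fun e he heY => ?_⟩
    · have := (balancedOdd n (m + 1)).compl.edges_subset
      rwa [show (balancedOdd n (m + 1)).compl.verts = range n from hRR'] at this
    · rw [hYX e he heY]
      change _ ↔ e.image f ∈ (R ∪ R').powersetCard (m + 1) \ (balancedOdd n (m + 1)).edges
      rw [mem_sdiff, hodd e he, hRR', and_iff_right (himg e he)]
      simp [hb]
  · left
    refine ⟨H₁, hcopy, hverts, hbound _ ?_ fun e he heY => ?_⟩
    · have := (balancedOdd n (m + 1)).edges_subset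
      rwa [show (balancedOdd n (m + 1)).verts = range n from hRR'] at this
    · rw [hYX e he heY, hodd e he]
      simp [hb]

/-! ### Assembly of the dichotomy -/

/-- Under a vertex degree condition, `H` is close to a parity hypergraph or any two vertices are
reachable. -/
theorem exists_isClose_or_reach {m : ℕ} (hm : 1 ≤ m) {ε : ℝ} (hε : 0 < ε) :
    ∃ τ γ : ℝ, 0 < τ ∧ τ ≤ 1 / 12 ∧ 0 < γ ∧ ∃ n₀ : ℕ, ∀ {V : Type u} [DecidableEq V]
      (H : UniformHypergraph V (m + 1)), n₀ ≤ #H.verts → H.HasLargeLinks τ →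
      H.IsClose ε (balancedOdd #H.verts (m + 1)) ∨
      H.IsClose ε (balancedOdd #H.verts (m + 1)).compl ∨
      ∀ x ∈ H.verts, ∀ y ∈ H.verts,
        H.Reach γ (1 + (m + m + m * m) + (m + m + m * m)) x y := by
  classical
  have hω : 0 < ε / 3 := by positivity
  obtain ⟨κ, hκ, n₁, h₁⟩ := exists_parity.{u} hm hω rfl
  -- With `τ ≤ θ` the error `7 (τ + θ)` of `HasLargeLinks.card_symmDiff_le` is at most `κ`. Below,
  -- `η` and `μ` each take half of `θ`, and `η ≤ κ / 2` because the exceptional set is a union of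
  -- two sets of size at most `η n`.
  set θ := κ / 14 with hθ
  have hθ0 : 0 < θ := by positivity
  have hf : (0 : ℝ) < m.factorial := by positivity
  set η := min (κ / 2) (min (ε / 3) (θ / (2 * m.factorial))) with hη
  have hη0 : 0 < η := by positivity
  have hη1 : η ≤ κ / 2 := min_le_left _ _
  have hη2 : η ≤ ε / 3 := (min_le_right _ _).trans (min_le_left _ _)
  have hη3 : η ≤ θ / (2 * m.factorial) := (min_le_right _ _).trans (min_le_right _ _)
  set μ := θ / (2 * (m + 1) * m.factorial) with hμ
  have hμ0 : 0 < μ := by positivity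
  have hθη : (η + (m + 1) * μ) * m.factorial ≤ θ := by
    rw [le_div_iff₀ (by positivity)] at hη3
    have : (m + 1) * μ * m.factorial = θ / 2 := by rw [hμ]; field_simp
    linarith
  obtain ⟨γ, hγ, n₂, h₂⟩ := exists_reach_or_partition.{u} m hη0 hμ0 rfl
  obtain ⟨n₃, hn₃⟩ := exists_forall_le_mul 1 hω
  refine ⟨min (1 / 12) θ, γ, by positivity, min_le_left _ _, hγ, max (max n₁ n₂) n₃,
    fun {V} _ H hn hL => ?_⟩
  simp only [max_le_iff] at hn
  obtain ⟨⟨hn1, hn2⟩, hn3⟩ := hn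
  rw [← or_assoc]
  rcases h₂ H hn2 _ (min_le_left _ _) hL with h | ⟨A, B, hA, hB, hAB, hC, hcA, hcB, x, hx, y, hy,
    hxy, hexc⟩
  · exact Or.inr h
  left
  set I := H.linkIndices A (A ∪ B) μ x
  set J := H.linkIndices A (A ∪ B) μ y
  set E := (H.verts \ (A ∪ B)) ∪ {z ∈ H.verts | ¬ Disjoint I
    (H.linkIndices A (A ∪ B) μ z) ∧ ¬ Disjoint (H.linkIndices A (A ∪ B) μ z) J} with hE
  have hEc : (#E : ℝ) ≤ κ * #H.verts := by
    refine (Nat.cast_le.2 (card_union_le _ _)).trans ?_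
    push_cast
    have : 2 * η * #H.verts ≤ κ * #H.verts := by gcongr; linarith
    linarith
  have hτ : (0 : ℝ) ≤ min (1 / 12) θ := by positivity
  have hκτ : 7 * (min (1 / 12) θ + θ) ≤ κ := by
    have := min_le_right (1 / 12) θ
    linarith
  obtain ⟨hI, hI'⟩ := hL.card_symmDiff_le hm hC hμ0.le hτ hθη hθ0.le hκτ hx hy hxy
  obtain ⟨hJ, hJ'⟩ := hL.card_symmDiff_le hm hC hμ0.le hτ hθη hθ0.le hκτ hy hx hxy.symm
  obtain ⟨b, hbal, X, hXc, hX⟩ := h₁ H hn1 A B E I J hA hB hAB subset_union_left hEc hcA hcB hxy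
    hI hJ (fun z hz => by
      rw [hE, mem_sdiff, mem_union, not_or, mem_filter] at hz
      -- Outside `E` the indices of `z` miss `I` or miss `J`, and the link of `z` is then described
      -- by the other slice.
      have h1 : Disjoint I (H.linkIndices A (A ∪ B) μ z) ∨
          Disjoint (H.linkIndices A (A ∪ B) μ z) J := by
        by_contra! hcon
        exact hz.2.2 ⟨hz.1, hcon⟩
      rcases h1 with h1 | h1
      · exact Or.inr (hJ' z hz.1 h1.symm)
      · exact Or.inl (hI' z hz.1 h1))
  have hclose := isClose_of_parity H hA (ω := ε / 3) ?_ (hn₃ _ hn3) hXc hX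
  · rwa [mul_div_cancel₀ ε (by norm_num : (3 : ℝ) ≠ 0)] at hclose
  -- Here `2 |A| - n` is `|A| - |B|` minus the number of uncovered vertices, and both terms are at
  -- most `ω n` in absolute value with `ω = ε / 3`.
  · have h1 : #(H.verts \ (A ∪ B)) + (#A + #B) = #H.verts := by
      rw [← card_union_of_disjoint hAB]
      exact card_sdiff_add_card_eq_card (union_subset hA hB)
    have h2 : (#(H.verts \ (A ∪ B)) : ℝ) + (#A + #B) = #H.verts := by exact_mod_cast h1
    have h3 : (#(H.verts \ (A ∪ B)) : ℝ) ≤ ε / 3 * #H.verts := hC.trans (by gcongr)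
    have h4 : (0 : ℝ) ≤ #(H.verts \ (A ∪ B)) := Nat.cast_nonneg _
    rw [abs_le] at hbal ⊢
    constructor <;> linarith

/-- The absorbing theorem: a hypergraph whose minimum `l`-degree is almost half of the maximum
possible value is close to a parity hypergraph or has a small absorbing matching. -/
theorem exists_isClose_or_absorbing {m l : ℕ} (hl : 1 ≤ l) (hlm : l ≤ m) {ε : ℝ} (hε : 0 < ε) :
    ∃ α ξ : ℝ, 0 < α ∧ 0 < ξ ∧ ∃ n₀ : ℕ, ∀ {V : Type u} [DecidableEq V]
      (H : UniformHypergraph V (m + 1)), n₀ ≤ #H.verts →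
      (1 / 2 - α) * ((#H.verts - l).choose (m + 1 - l) : ℝ) ≤ H.minDegree l →
      H.IsClose ε (balancedOdd #H.verts (m + 1)) ∨
      H.IsClose ε (balancedOdd #H.verts (m + 1)).compl ∨
      ∃ M : Finset (Finset V), H.IsMatching M ∧ (#M : ℝ) ≤ ξ * #H.verts / (m + 1 : ℕ) ∧
        ∀ W : Finset V, W ⊆ H.verts \ support M → m + 1 ∣ #W →
          (#W : ℝ) ≤ ξ ^ 2 * #H.verts → H.Absorbs M W := by
  obtain ⟨τ, γ, hτ, hτ', hγ, n₁, h₁⟩ := exists_isClose_or_reach.{u} (hl.trans hlm) hε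
  obtain ⟨γ', hγ', n₂, h₂⟩ := exists_dense_absorber.{u} hγ
    (by positivity : (0 : ℝ) < 1 / (4 * (m + 1).factorial)) (m + 1)
    (1 + (m + m + m * m) + (m + m + m * m))
  obtain ⟨ξ, hξ, n₃, h₃⟩ := exists_absorbing_matching.{u} hγ'
    (c := m + 1 + (m + 1) * (1 + (m + m + m * m) + (m + m + m * m))) (by omega) (Nat.succ_pos m)
  obtain ⟨n₄, h₄⟩ := exists_forall_le_choose_pred m hτ
  -- The remaining half of `τ` pays for passing from the binomial to `n ^ m / m!`, as `(1 / 2 - τ /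
  -- 2) (1 - τ) ≥ 1 / 2 - τ`.
  refine ⟨τ / 2, ξ, by positivity, hξ, max (max n₁ n₂) (max n₃ n₄), fun {V} _ H hn hdeg => ?_⟩
  simp only [max_le_iff] at hn
  obtain ⟨⟨hn1, hn2⟩, hn3, hn4⟩ := hn
  have hL : H.HasLargeLinks τ := by
    intro x hx
    refine le_trans ?_ (le_card_link hl hlm hdeg hx)
    have h5 := h₄ _ hn4
    have hN : 0 ≤ (#H.verts : ℝ) ^ m / m.factorial := by positivity
    calc (1 / 2 - τ) * ((#H.verts : ℝ) ^ m / m.factorial)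
        ≤ (1 / 2 - τ / 2) * ((1 - τ) * ((#H.verts : ℝ) ^ m / m.factorial)) := by
          rw [← mul_assoc]
          gcongr
          nlinarith
      _ ≤ _ := by
          refine mul_le_mul_of_nonneg_left h5 ?_
          linarith
  rcases h₁ H hn1 hL with h | h | h
  · exact Or.inl h
  · exact Or.inr (Or.inl h)
  · exact Or.inr (Or.inr (h₃ H hn3 (h₂ H hn2 (hL.dense_edges (by linarith)) h)))

end UniformHypergraph

theorem theorem3p1 (ε : ℝ) (hε : 0 < ε) (k l : ℕ) (hk : 3 ≤ k) (hkl : (k : ℝ) / 2 ≤ (l : ℝ))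
    (hlk : l ≤ k - 1) :
    ∃ α ξ : ℝ, 0 < α ∧ 0 < ξ ∧ ∃ n₀ : ℕ,
      ∀ (V : Type*) [DecidableEq V] (H : UniformHypergraph V k) (n : ℕ),
        #H.verts = n → n₀ ≤ n →
        (1 / 2 - α) * ((n - l).choose (k - l) : ℝ) ≤ (H.minDegree l : ℝ) →
          H.IsClose ε (UniformHypergraph.balancedOdd n k) ∨
          H.IsClose ε (UniformHypergraph.balancedOdd n k).compl ∨
          ∃ M : Finset (Finset V), H.IsMatching M ∧ (#M : ℝ) ≤ ξ * n / k ∧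
            ∀ W : Finset V, W ⊆ H.verts \ UniformHypergraph.support M → k ∣ #W →
              (#W : ℝ) ≤ ξ ^ 2 * n → H.Absorbs M W := by
  obtain ⟨m, rfl⟩ : ∃ m, k = m + 1 := ⟨k - 1, by omega⟩
  have hl : 1 ≤ l := by
    by_contra! h
    have h0 : l = 0 := by omega
    rw [h0] at hkl
    push_cast at hkl
    linarith [(Nat.cast_nonneg m : (0 : ℝ) ≤ m)]
  obtain ⟨α, ξ, hα, hξ, n₀, h⟩ :=
    UniformHypergraph.exists_isClose_or_absorbing hl (by omega : l ≤ m) hε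
  refine ⟨α, ξ, hα, hξ, n₀, ?_⟩
  rintro V _ H n rfl hn hdeg
  exact h H hn hdeg
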